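/- For $n\in\mathbb N=\{0,1,2,\dots\}$ let $H_n(x)=(-1)^n e^{x^2}\frac{d^n}{dx^n}e^{-x^2}$ be the (physicists') Hermite polynomials. Let $V:\mathbb R\to\mathbb R$ satisfy $V\in L^2(\mathbb R,e^{-x^2}dx)$ and $V(x)\to\infty$ as $|x|\to\infty$. Then $V$ has a Hermite expansion $V=\sum_{j=0}^\infty v_jH_j$, convergent in $L^2(\mathbb R,e^{-x^2}dx)$, and the eigenvalues of the Schrödinger operator $-d^2/dx^2+V$ on $L^2(\mathbb R)$ (the numbers $\lambda$ for which $-u''+Vu=\lambda u$ a.e. on $\mathbb R$ has a nonzero solution $u\in L^2(\mathbb R)$ with $u,u'$ locally absolutely continuous) can be listed, with multiplicity, as a sequence $\lambda_0\le\lambda_1\le\lambda_2\le\dots\to\infty$. For this expansion and this sequence, and for every $n\in\mathbb N$, $$\sum_{k=0}^n\lambda_k\;\le\;\sum_{k=0}^n\frac{2^k(2k)!}{k!}\binom{n+1}{k+1}v_{2k}+\frac12(n+1)^2 .$$ For $V(x)=x^2$, which satisfies the hypotheses, equality holds for every $n\in\mathbb N$. -/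

import Mathlib

open MeasureTheory Filter Topology Polynomial

noncomputable section

/-- The physicists' Hermite polynomials `H_n(x) = (-1)^n e^{x^2} (d/dx)^n e^{-x^2}`, generated by
`H_0 = 1` and `H_{n+1} = 2 x H_n - H_n'`. -/
def physHermite : ℕ → ℝ[X]
  | 0 => 1
  | n + 1 => 2 * X * physHermite n - derivative (physHermite n)

/-- The measure `e^{-x^2} dx` on the real line. -/
def hermiteMeasure : Measure ℝ :=
  volume.withDensity fun x => ENNReal.ofReal (Real.exp (-x ^ 2))

/-- `V = ∑ v_j H_j`, the series converging in `L²(ℝ, e^{-x^2} dx)`. -/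
def HasHermiteExpansion (V : ℝ → ℝ) (v : ℕ → ℝ) : Prop :=
  Tendsto
    (fun N : ℕ => eLpNorm
      (fun x => V x - ∑ j ∈ Finset.range N, v j * (physHermite j).eval x) 2 hermiteMeasure)
    atTop (𝓝 0)

/-- `u` belongs to `L²(ℝ)`, `u` and `u'` are (locally) absolutely continuous, and
`-u'' + V u = μ u` almost everywhere on the real line. Such a `u` lies in the domain
`{u ∈ L² : u, u' locally absolutely continuous, -u'' + V u ∈ L²}` of the Schrödinger operator
`-d²/dx² + V`, and the nonzero ones are its eigenfunctions for the eigenvalue `μ`.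
(That `u` itself is absolutely continuous follows, as `u'` is continuous.) -/
structure IsL2Solution (V : ℝ → ℝ) (μ : ℝ) (u : ℝ → ℝ) : Prop where
  memLp : MemLp u 2 volume
  differentiable : Differentiable ℝ u
  absolutelyContinuous_deriv : ∀ a b : ℝ, AbsolutelyContinuousOnInterval (deriv u) a b
  equation : ∀ᵐ x : ℝ, -deriv (deriv u) x + V x * u x = μ * u x

lemma IsL2Solution.ae_differentiableAt {V : ℝ → ℝ} {μ : ℝ} {u : ℝ → ℝ}
    (h : IsL2Solution V μ u) : ∀ᵐ x : ℝ, DifferentiableAt ℝ (deriv u) x := by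
  have h1 : ∀ n : ℕ, ∀ᵐ x : ℝ, x ∈ Set.uIcc (-(n : ℝ)) n → DifferentiableAt ℝ (deriv u) x :=
    fun n => (h.absolutelyContinuous_deriv _ _).ae_differentiableAt
  filter_upwards [ae_all_iff.2 h1] with x hx
  obtain ⟨n, hn⟩ := exists_nat_ge |x|
  refine hx n ?_
  rw [Set.uIcc_of_le (by linarith [abs_nonneg x])]
  exact abs_le.1 hn

/-- The eigenspace of the Schrödinger operator `-d²/dx² + V` on `L²(ℝ)` for the number `μ`
(a continuous function is determined by its class in `L²`, so functions may be used). -/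
def schrodingerEigenspace (V : ℝ → ℝ) (μ : ℝ) : Submodule ℝ (ℝ → ℝ) where
  carrier := {u | IsL2Solution V μ u}
  zero_mem' := by
    have h0 : deriv (0 : ℝ → ℝ) = fun _ => 0 := by
      ext x
      simp
    refine ⟨MemLp.zero, differentiable_const (0 : ℝ), fun a b => ?_, ?_⟩
    · rw [h0]
      exact (contDiffOn_const).absolutelyContinuousOnInterval
    · rw [h0]
      simp
  add_mem' := by
    intro u w hu hw
    have hd : deriv (u + w) = deriv u + deriv w := by
      ext x
      exact deriv_add (hu.differentiable x) (hw.differentiable x)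
    refine ⟨hu.memLp.add hw.memLp, hu.differentiable.add hw.differentiable, fun a b => ?_, ?_⟩
    · rw [hd]
      exact (hu.absolutelyContinuous_deriv a b).add (hw.absolutelyContinuous_deriv a b)
    · filter_upwards [hu.equation, hw.equation, hu.ae_differentiableAt, hw.ae_differentiableAt]
        with x h1 h2 h3 h4
      rw [hd, deriv_add h3 h4, Pi.add_apply]
      linarith
  smul_mem' := by
    intro c u hu
    have hd : deriv (c • u) = fun x => c • deriv u x := by
      ext x
      exact deriv_const_smul c (hu.differentiable x)
    refine ⟨hu.memLp.const_smul c, hu.differentiable.const_smul c, fun a b => ?_, ?_⟩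
    · rw [hd]
      exact (hu.absolutelyContinuous_deriv a b).const_smul c
    · filter_upwards [hu.equation, hu.ae_differentiableAt] with x h1 h3
      have h5 : deriv (fun y => c • deriv u y) x = c • deriv (deriv u) x :=
        deriv_const_smul c h3
      rw [hd, h5, Pi.smul_apply, smul_eq_mul, smul_eq_mul]
      linear_combination c * h1

/-- `lam 0 ≤ lam 1 ≤ ⋯ → ∞` lists the eigenvalues of `-d²/dx² + V` on `L²(ℝ)`, every eigenvalue
occurring as often as its multiplicity (and no other number occurring). -/
structure IsEigenvalueSequence (V : ℝ → ℝ) (lam : ℕ → ℝ) : Prop where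
  monotone : Monotone lam
  tendsto : Tendsto lam atTop atTop
  multiplicity : ∀ μ : ℝ,
    Cardinal.mk {k : ℕ // lam k = μ} = Module.rank ℝ (schrodingerEigenspace V μ)

/-- The explicit bound
`∑_{k=0}^n (2^k (2k)! / k!) binom(n+1, k+1) v_{2k} + (n+1)^2 / 2`. -/
def hermiteBound (v : ℕ → ℝ) (n : ℕ) : ℝ :=
  ∑ k ∈ Finset.range (n + 1),
      (2 ^ k * ((2 * k).factorial : ℝ) / (k.factorial : ℝ)) * ((n + 1).choose (k + 1) : ℝ)
        * v (2 * k)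
    + ((n : ℝ) + 1) ^ 2 / 2

end

/-! After a shift by a constant, the quadratic form `∫ u' v' + ∫ V u v` is coercive, and its domain
embeds compactly into `L²(ℝ)` because `V → ∞`. The inverse of the associated operator is therefore
compact, which yields the eigenvalue sequence, and the variational principle bounds
`λ₀ + ⋯ + λₙ` by the sum of the energies of any `n + 1` orthonormal trial functions. Take the first
Hermite functions. The kinetic energy of the `k`-th one is `k + 1/2`. Its potential energy is
`∑ r, 2^r (2r)! / r! · binom(k, r) v_{2r}`, since repeated integration by parts against `H_j` turns
`∫ H_j H_k² e^{-x²}` into a sum of integrals of products of derivatives of `H_k`, which are again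
Hermite polynomials, and orthogonality leaves one term. Summing over `k` gives the bound.

For `V = x²` the Hermite functions are themselves eigenfunctions, so the variational principle also
applies with the roles of the two orthonormal systems exchanged. -/

/-! ### Hermite polynomials -/

lemma derivative_physHermite_succ (n : ℕ) :
    derivative (physHermite (n + 1)) = (2 * ((n : ℝ) + 1)) • physHermite n := by
  induction n with
  | zero => simp [physHermite, derivative_mul, smul_eq_C_mul, ← C_ofNat]
  | succ n ih =>
    rw [physHermite, derivative_sub, derivative_mul, ih, derivative_smul]
    simp only [physHermite, derivative_mul, derivative_ofNat, derivative_X, smul_eq_C_mul,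
      map_mul, map_add, map_ofNat, map_one, map_natCast]
    push_cast
    ring

lemma iterate_derivative_physHermite (r n : ℕ) :
    derivative^[r] (physHermite n) = (2 ^ r * (n.descFactorial r : ℝ)) • physHermite (n - r) := by
  induction r with
  | zero => simp
  | succ r ih =>
    rw [Function.iterate_succ_apply', ih, derivative_smul]
    rcases Nat.lt_or_ge r n with h | h
    · obtain ⟨m, rfl⟩ := Nat.exists_eq_add_of_lt h
      rw [show r + m + 1 - r = m + 1 by omega, show r + m + 1 - (r + 1) = m by omega,
        derivative_physHermite_succ, smul_smul, Nat.descFactorial_succ,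
        show r + m + 1 - r = m + 1 by omega]
      push_cast
      ring_nf
    · simp [Nat.sub_eq_zero_of_le h, physHermite]

lemma degree_physHermite (n : ℕ) : (physHermite n).degree = n := by
  induction n with
  | zero => simp [physHermite]
  | succ n ih =>
    have hX : (2 * X * physHermite n).degree = ((n + 1 : ℕ) : WithBot ℕ) := by
      rw [show (2 : ℝ[X]) = C 2 from rfl, degree_mul, degree_C_mul_X two_ne_zero, ih]
      push_cast
      exact add_comm _ _
    rw [physHermite, degree_sub_eq_left_of_degree_lt, hX]
    rw [hX]
    refine (degree_derivative_lt (degree_ne_bot.1 (by simp [ih]))).trans ?_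
    rw [ih]
    exact_mod_cast n.lt_succ_self

lemma span_physHermite : Submodule.span ℝ (Set.range physHermite) = ⊤ :=
  let S : Polynomial.Sequence ℝ := ⟨physHermite, degree_physHermite⟩
  S.span fun i => (leadingCoeff_ne_zero.2 (S.ne_zero i)).isUnit

/-! ### The moment problem for measures with exponential moments -/

/-- All exponential moments of the measure `μ` on the line are finite; `t = 0` says that `μ` itself
is finite. Such a measure is determined by its moments, and polynomials are dense in its `L²`. -/
def HasExponentialMoments (μ : Measure ℝ) : Prop :=
  ∀ t : ℝ, Integrable (fun x => Real.exp (t * x)) μ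

namespace HasExponentialMoments

open ProbabilityTheory

variable {μ ν : Measure ℝ}

lemma isFiniteMeasure (hμ : HasExponentialMoments μ) : IsFiniteMeasure μ :=
  (integrable_const_iff_isFiniteMeasure one_ne_zero).1 (by simpa using hμ 0)

lemma integrableExpSet_eq_univ (hμ : HasExponentialMoments μ) :
    integrableExpSet id μ = Set.univ :=
  Set.eq_univ_of_forall hμ

lemma memLp_exp (hμ : HasExponentialMoments μ) (t : ℝ) :
    MemLp (fun x => Real.exp (t * x)) 2 μ := by
  rw [memLp_two_iff_integrable_sq (by fun_prop)]
  refine (hμ (2 * t)).congr (Eventually.of_forall fun x => ?_)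
  simp only [← Real.exp_nat_mul]
  push_cast
  ring_nf

lemma integrable_polynomial (hμ : HasExponentialMoments μ) (P : ℝ[X]) :
    Integrable (fun x => P.eval x) μ := by
  simp only [eval_eq_sum_range]
  refine integrable_finsetSum _ fun n _ => Integrable.const_mul ?_ _
  exact integrable_pow_of_mem_interior_integrableExpSet (X := id)
    (by simp [hμ.integrableExpSet_eq_univ]) n

lemma memLp_polynomial (hμ : HasExponentialMoments μ) (P : ℝ[X]) :
    MemLp (fun x => P.eval x) 2 μ := by
  rw [memLp_two_iff_integrable_sq P.continuous.aestronglyMeasurable]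
  simpa only [← eval_pow] using hμ.integrable_polynomial (P ^ 2)

lemma analyticOnNhd_mgf (hμ : HasExponentialMoments μ) :
    AnalyticOnNhd ℝ (mgf id μ) Set.univ := by
  simpa [hμ.integrableExpSet_eq_univ] using ProbabilityTheory.analyticOnNhd_mgf (X := id) (μ := μ)

lemma hasFPowerSeriesAt_mgf (hμ : HasExponentialMoments μ) :
    HasFPowerSeriesAt (mgf id μ)
      (FormalMultilinearSeries.ofScalars ℝ fun n => (∫ x, x ^ n ∂μ) / n.factorial) 0 := by
  simpa using ProbabilityTheory.hasFPowerSeriesAt_mgf (X := id) (μ := μ) (v := 0)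
    (by simp [hμ.integrableExpSet_eq_univ])

lemma mgf_eq_of_moments_eq (hμ : HasExponentialMoments μ) (hν : HasExponentialMoments ν)
    (h : ∀ n : ℕ, ∫ x, x ^ n ∂μ = ∫ x, x ^ n ∂ν) : mgf id μ = mgf id ν := by
  refine hμ.analyticOnNhd_mgf.eq_of_eventuallyEq hν.analyticOnNhd_mgf (z₀ := 0) ?_
  have hsub := hμ.hasFPowerSeriesAt_mgf.sub hν.hasFPowerSeriesAt_mgf
  simp only [h, sub_self] at hsub
  filter_upwards [hsub.eventually_eq_zero] with x hx
  exact sub_eq_zero.1 hx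

lemma eq_of_moments_eq (hμ : HasExponentialMoments μ) (hν : HasExponentialMoments ν)
    (h : ∀ n : ℕ, ∫ x, x ^ n ∂μ = ∫ x, x ^ n ∂ν) : μ = ν := by
  have := hμ.isFiniteMeasure
  have := hν.isFiniteMeasure
  have hmass : μ Set.univ = ν Set.univ := by
    simpa [measureReal_def, ENNReal.toReal_eq_toReal_iff'] using h 0
  refine Measure.ext_of_complexMGF_id_eq (funext fun z => ?_)
  refine eqOn_complexMGF_of_mgf' (mgf_eq_of_moments_eq hμ hν h) ?_
    (by simp [hμ.integrableExpSet_eq_univ])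
  rw [← Measure.measure_univ_eq_zero, hmass, Measure.measure_univ_eq_zero]

end HasExponentialMoments

section PositivePart

variable {α : Type*} [MeasurableSpace α] {μ : Measure α} {f g : α → ℝ}

lemma integral_withDensity_ofReal (hg : AEMeasurable g μ) (f : α → ℝ) :
    ∫ x, f x ∂μ.withDensity (fun x => ENNReal.ofReal (g x)) = ∫ x, max (g x) 0 * f x ∂μ := by
  rw [integral_withDensity_eq_integral_toReal_smul₀ hg.ennreal_ofReal (by simp)]
  simp [ENNReal.toReal_ofReal']

lemma integrable_withDensity_ofReal (hf : MemLp f 2 μ) (hg : MemLp g 2 μ) :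
    Integrable f (μ.withDensity fun x => ENNReal.ofReal (g x)) := by
  rw [integrable_withDensity_iff_integrable_smul₀' hg.1.aemeasurable.ennreal_ofReal (by simp)]
  simp only [ENNReal.toReal_ofReal', smul_eq_mul]
  exact hg.pos_part.integrable_mul hf

lemma ae_eq_zero_of_withDensity_ofReal_eq_neg [IsFiniteMeasure μ] (hg : AEMeasurable g μ)
    (h : μ.withDensity (fun x => ENNReal.ofReal (g x)) =
      μ.withDensity fun x => ENNReal.ofReal ((-g) x)) : g =ᵐ[μ] 0 := by
  rw [withDensity_eq_iff_of_sigmaFinite hg.ennreal_ofReal hg.neg.ennreal_ofReal] at h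
  filter_upwards [h] with x hx
  have hmax : max (g x) 0 = max (-g x) 0 := by
    simpa [ENNReal.toReal_ofReal'] using congrArg ENNReal.toReal hx
  rw [Pi.zero_apply, ← max_zero_sub_max_neg_zero_eq_self (g x), hmax, sub_self]

end PositivePart

/-- The moments of `g⁺ μ` and `g⁻ μ` agree, so these measures do. -/
lemma HasExponentialMoments.ae_eq_zero_of_forall_integral_pow_mul {μ : Measure ℝ} {g : ℝ → ℝ}
    (hμ : HasExponentialMoments μ) (hg : MemLp g 2 μ) (h : ∀ n : ℕ, ∫ x, x ^ n * g x ∂μ = 0) :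
    g =ᵐ[μ] 0 := by
  have := hμ.isFiniteMeasure
  have hpow (n : ℕ) : MemLp (fun x : ℝ => x ^ n) 2 μ := by
    simpa using hμ.memLp_polynomial (X ^ n)
  refine ae_eq_zero_of_withDensity_ofReal_eq_neg hg.1.aemeasurable <|
    eq_of_moments_eq (fun t => integrable_withDensity_ofReal (hμ.memLp_exp t) hg)
      (fun t => integrable_withDensity_ofReal (hμ.memLp_exp t) hg.neg) fun n => ?_
  calc ∫ x, x ^ n ∂μ.withDensity (fun x => ENNReal.ofReal (g x))
      = ∫ x, max (g x) 0 * x ^ n ∂μ := integral_withDensity_ofReal hg.1.aemeasurable _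
    _ = ∫ x, (x ^ n * g x + max ((-g) x) 0 * x ^ n) ∂μ := by
      refine integral_congr_ae (Eventually.of_forall fun x => ?_)
      simp only [Pi.neg_apply]
      linear_combination x ^ n * max_zero_sub_max_neg_zero_eq_self (g x)
    _ = ∫ x, max ((-g) x) 0 * x ^ n ∂μ := by
      refine (integral_add ((hpow n).integrable_mul hg)
        (hg.neg.pos_part.integrable_mul (hpow n))).trans ?_
      simp only [Pi.mul_apply, h n, zero_add]
    _ = ∫ x, x ^ n ∂μ.withDensity (fun x => ENNReal.ofReal ((-g) x)) :=
      (integral_withDensity_ofReal hg.1.aemeasurable.neg _).symm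

/-! ### The Gaussian weight -/

lemma measurable_gaussianDensity :
    Measurable fun x : ℝ => ENNReal.ofReal (Real.exp (-x ^ 2)) := by fun_prop

lemma ae_hermiteMeasure : ae hermiteMeasure = ae volume :=
  le_antisymm (withDensity_absolutelyContinuous _ _).ae_le
    (withDensity_absolutelyContinuous' measurable_gaussianDensity.aemeasurable
      (by simp [Real.exp_pos])).ae_le

lemma aestronglyMeasurable_hermiteMeasure_iff {f : ℝ → ℝ} :
    AEStronglyMeasurable f hermiteMeasure ↔ AEStronglyMeasurable f volume :=
  ⟨fun h => h.mono_ac (Measure.ae_le_iff_absolutelyContinuous.1 ae_hermiteMeasure.ge),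
    fun h => h.mono_ac (Measure.ae_le_iff_absolutelyContinuous.1 ae_hermiteMeasure.le)⟩

lemma integrable_hermiteMeasure_iff {f : ℝ → ℝ} :
    Integrable f hermiteMeasure ↔ Integrable fun x => f x * Real.exp (-x ^ 2) := by
  rw [hermiteMeasure, integrable_withDensity_iff measurable_gaussianDensity (by simp)]
  simp [ENNReal.toReal_ofReal, Real.exp_nonneg]

lemma integral_hermiteMeasure (f : ℝ → ℝ) :
    ∫ x, f x ∂hermiteMeasure = ∫ x, f x * Real.exp (-x ^ 2) := by
  rw [hermiteMeasure,
    integral_withDensity_eq_integral_toReal_smul measurable_gaussianDensity (by simp)]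
  simp [ENNReal.toReal_ofReal, Real.exp_nonneg, mul_comm]

lemma exp_neg_sq_div_two_mul_self (x : ℝ) :
    Real.exp (-x ^ 2 / 2) * Real.exp (-x ^ 2 / 2) = Real.exp (-x ^ 2) := by
  rw [← Real.exp_add, add_halves]

lemma memLp_hermiteMeasure_iff {f : ℝ → ℝ} :
    MemLp f 2 hermiteMeasure ↔ MemLp (fun x => f x * Real.exp (-x ^ 2 / 2)) 2 volume := by
  have hmeas : AEStronglyMeasurable (fun x => f x * Real.exp (-x ^ 2 / 2)) volume ↔
      AEStronglyMeasurable f volume := by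
    refine ⟨fun h => ?_, fun h => h.mul (by fun_prop : Continuous _).aestronglyMeasurable⟩
    have hinv : Continuous fun x : ℝ => Real.exp (x ^ 2 / 2) := by fun_prop
    refine (h.mul hinv.aestronglyMeasurable).congr (Eventually.of_forall fun x => ?_)
    simp [mul_assoc, ← Real.exp_add, neg_div]
  by_cases hf : AEStronglyMeasurable f volume
  · rw [memLp_two_iff_integrable_sq (aestronglyMeasurable_hermiteMeasure_iff.2 hf),
      memLp_two_iff_integrable_sq (hmeas.2 hf), integrable_hermiteMeasure_iff]
    simp only [mul_pow, sq (Real.exp _), exp_neg_sq_div_two_mul_self]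
  · exact ⟨fun h => (hf (aestronglyMeasurable_hermiteMeasure_iff.1 h.1)).elim,
      fun h => (hf (hmeas.1 h.1)).elim⟩

lemma hasExponentialMoments_hermiteMeasure : HasExponentialMoments hermiteMeasure := fun t => by
  rw [integrable_hermiteMeasure_iff]
  refine (((integrable_exp_neg_mul_sq one_pos).comp_sub_right (t / 2)).const_mul
    (Real.exp (t ^ 2 / 4))).congr (Eventually.of_forall fun x => ?_)
  simp only [← Real.exp_add]
  ring_nf

instance : IsFiniteMeasure hermiteMeasure := hasExponentialMoments_hermiteMeasure.isFiniteMeasure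

lemma memLp_polynomial_hermiteMeasure (P : ℝ[X]) :
    MemLp (fun x => P.eval x) 2 hermiteMeasure :=
  hasExponentialMoments_hermiteMeasure.memLp_polynomial P

lemma integrable_mul_polynomial {V : ℝ → ℝ} (hV : MemLp V 2 hermiteMeasure) (P : ℝ[X]) :
    Integrable (fun x => V x * P.eval x) hermiteMeasure :=
  hV.integrable_mul (memLp_polynomial_hermiteMeasure P)

/-- The integral of a polynomial against the Gaussian weight `e^{-x^2}`, as a linear form. -/
noncomputable def gaussInt : ℝ[X] →ₗ[ℝ] ℝ where
  toFun P := ∫ x, P.eval x ∂hermiteMeasure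
  map_add' P Q := by
    simp only [eval_add]
    exact integral_add (hasExponentialMoments_hermiteMeasure.integrable_polynomial P)
      (hasExponentialMoments_hermiteMeasure.integrable_polynomial Q)
  map_smul' a P := by
    simp only [eval_smul, RingHom.id_apply]
    exact integral_smul a _

lemma gaussInt_apply (P : ℝ[X]) : gaussInt P = ∫ x, P.eval x ∂hermiteMeasure := rfl

lemma gaussInt_one : gaussInt 1 = √Real.pi := by
  rw [gaussInt_apply, integral_hermiteMeasure]
  simpa using integral_gaussian 1

lemma gaussInt_two_X_mul_sub_derivative (P : ℝ[X]) : gaussInt (2 * X * P - derivative P) = 0 := by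
  have hderiv (x : ℝ) : HasDerivAt (fun x => P.eval x * Real.exp (-x ^ 2))
      (-((2 * X * P - derivative P).eval x * Real.exp (-x ^ 2))) x := by
    refine ((P.hasDerivAt x).mul (hasDerivAt_pow 2 x).neg.exp).congr_deriv ?_
    simp
    ring
  have hint (Q : ℝ[X]) : Integrable fun x => Q.eval x * Real.exp (-x ^ 2) :=
    integrable_hermiteMeasure_iff.1 (hasExponentialMoments_hermiteMeasure.integrable_polynomial Q)
  rw [gaussInt_apply, integral_hermiteMeasure, ← neg_eq_zero, ← integral_neg]
  exact integral_eq_zero_of_hasDerivAt_of_integrable hderiv (hint _).neg (hint _)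

/-! ### Orthogonality of the Hermite polynomials -/

lemma gaussInt_physHermite_mul (n : ℕ) (Q : ℝ[X]) :
    gaussInt (physHermite n * Q) = gaussInt (derivative^[n] Q) := by
  induction n generalizing Q with
  | zero => simp [physHermite]
  | succ n ih =>
    have hsplit : physHermite (n + 1) * Q = (2 * X * (physHermite n * Q) -
        derivative (physHermite n * Q)) + physHermite n * derivative Q := by
      rw [derivative_mul, physHermite]
      ring
    rw [hsplit, map_add, gaussInt_two_X_mul_sub_derivative, zero_add, ih,
      Function.iterate_succ_apply]

/-- The squared norm `2^n n! √π` of `H_n` in `L²(e^{-x^2} dx)`. -/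
noncomputable def hermiteNormSq (n : ℕ) : ℝ := 2 ^ n * (n.factorial : ℝ) * √Real.pi

lemma hermiteNormSq_pos (n : ℕ) : 0 < hermiteNormSq n := by
  have := Real.pi_pos
  unfold hermiteNormSq
  positivity

lemma gaussInt_physHermite_mul_physHermite (m n : ℕ) :
    gaussInt (physHermite m * physHermite n) = if m = n then hermiteNormSq n else 0 := by
  wlog h : n ≤ m generalizing m n
  · rw [mul_comm, this n m (le_of_not_ge h)]
    grind
  rw [gaussInt_physHermite_mul, iterate_derivative_physHermite, map_smul]
  rcases h.eq_or_lt with rfl | h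
  · simp [physHermite, gaussInt_one, hermiteNormSq, Nat.descFactorial_self]
  · simp [Nat.descFactorial_of_lt h, h.ne']

lemma hermiteNormSq_eq_descFactorial_mul {i k : ℕ} (h : i ≤ k) :
    hermiteNormSq k = 2 ^ i * k.descFactorial i * hermiteNormSq (k - i) := by
  rw [hermiteNormSq, hermiteNormSq, ← Nat.factorial_mul_descFactorial h,
    ← pow_sub_mul_pow (2 : ℝ) h]
  push_cast
  ring

lemma gaussInt_iterate_derivative_mul_iterate_derivative (i j k : ℕ) :
    gaussInt (derivative^[i] (physHermite k) * derivative^[j] (physHermite k)) =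
      if i = j then 2 ^ i * k.descFactorial i * hermiteNormSq k else 0 := by
  rw [iterate_derivative_physHermite, iterate_derivative_physHermite, smul_mul_smul_comm,
    map_smul, smul_eq_mul, gaussInt_physHermite_mul_physHermite]
  rcases lt_or_ge k i with hi | hi
  · simp [Nat.descFactorial_of_lt hi]
  rcases lt_or_ge k j with hj | hj
  · simp [Nat.descFactorial_of_lt hj, show i ≠ j by omega]
  rcases eq_or_ne i j with rfl | hij
  · rw [if_pos rfl, if_pos rfl, hermiteNormSq_eq_descFactorial_mul hi]
    ring
  · rw [if_neg hij, if_neg (by omega), mul_zero]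

lemma gaussInt_physHermite_mul_sq (j k : ℕ) :
    gaussInt (physHermite j * physHermite k ^ 2) =
      ∑ i ∈ Finset.range (j + 1), (j.choose i : ℝ) *
        gaussInt (derivative^[j - i] (physHermite k) * derivative^[i] (physHermite k)) := by
  rw [gaussInt_physHermite_mul, sq, iterate_derivative_mul, map_sum]
  exact Finset.sum_congr rfl fun i _ => by rw [map_nsmul, nsmul_eq_mul]

lemma choose_mul_descFactorial (r k : ℕ) :
    ((2 * r).choose r : ℝ) * k.descFactorial r =
      (2 * r).factorial / r.factorial * k.choose r := by
  have hr : (r.factorial : ℝ) ≠ 0 := by positivity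
  have hchoose : ((2 * r).choose r : ℝ) * r.factorial * r.factorial = (2 * r).factorial := by
    rw [two_mul]
    exact_mod_cast Nat.add_choose_mul_factorial_mul_factorial r r
  rw [Nat.descFactorial_eq_factorial_mul_choose, ← hchoose]
  push_cast
  field_simp

/-! ### Normalized Hermite polynomials -/

/-- The Hermite polynomials normalized in `L²(e^{-x^2} dx)`. -/
noncomputable def unitHermite (n : ℕ) : ℝ[X] := (√(hermiteNormSq n))⁻¹ • physHermite n

lemma gaussInt_unitHermite_mul_unitHermite (m n : ℕ) :
    gaussInt (unitHermite m * unitHermite n) = if m = n then 1 else 0 := by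
  rw [unitHermite, unitHermite, smul_mul_smul_comm, map_smul, gaussInt_physHermite_mul_physHermite]
  split_ifs with h
  · rw [h, ← mul_inv, Real.mul_self_sqrt (hermiteNormSq_pos n).le, smul_eq_mul,
      inv_mul_cancel₀ (hermiteNormSq_pos n).ne']
  · rw [smul_zero]

lemma unitHermite_sq (n : ℕ) : unitHermite n ^ 2 = (hermiteNormSq n)⁻¹ • physHermite n ^ 2 := by
  rw [unitHermite, _root_.smul_pow, inv_pow, Real.sq_sqrt (hermiteNormSq_pos n).le]

lemma gaussInt_unitHermite_sq (n : ℕ) : gaussInt (unitHermite n ^ 2) = 1 := by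
  rw [sq, gaussInt_unitHermite_mul_unitHermite, if_pos rfl]

lemma gaussInt_physHermite_odd_mul_unitHermite_sq (r k : ℕ) :
    gaussInt (physHermite (2 * r + 1) * unitHermite k ^ 2) = 0 := by
  rw [unitHermite_sq, mul_smul_comm, map_smul, gaussInt_physHermite_mul_sq,
    Finset.sum_eq_zero fun i _ => ?_, smul_zero]
  rw [gaussInt_iterate_derivative_mul_iterate_derivative, if_neg (by omega), mul_zero]

lemma gaussInt_physHermite_even_mul_unitHermite_sq (r k : ℕ) :
    gaussInt (physHermite (2 * r) * unitHermite k ^ 2) =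
      2 ^ r * (2 * r).factorial / r.factorial * k.choose r := by
  rw [unitHermite_sq, mul_smul_comm, map_smul, gaussInt_physHermite_mul_sq,
    Finset.sum_eq_single r (fun i _ hir => ?_) (fun h => (h (by simp; omega)).elim),
    gaussInt_iterate_derivative_mul_iterate_derivative, if_pos (by omega),
    show 2 * r - r = r by omega, smul_eq_mul]
  · have := (hermiteNormSq_pos k).ne'
    rw [mul_div_assoc, mul_assoc (2 ^ r : ℝ) (_ / _), ← choose_mul_descFactorial]
    field_simp
  · rw [gaussInt_iterate_derivative_mul_iterate_derivative, if_neg (by omega), mul_zero]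

lemma gaussInt_derivative_unitHermite_sq (n : ℕ) :
    gaussInt (derivative (unitHermite n) ^ 2) = 2 * n := by
  have hderiv := gaussInt_iterate_derivative_mul_iterate_derivative 1 1 n
  rw [Function.iterate_one, ← sq, if_pos rfl, Nat.descFactorial_one] at hderiv
  rw [unitHermite, derivative_smul, _root_.smul_pow, inv_pow, Real.sq_sqrt (hermiteNormSq_pos n).le,
    map_smul, hderiv, smul_eq_mul]
  have := (hermiteNormSq_pos n).ne'
  field_simp

lemma gaussInt_X_sq_mul_unitHermite_sq (n : ℕ) :
    gaussInt (X ^ 2 * unitHermite n ^ 2) = n + 1 / 2 := by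
  have hX : (X ^ 2 : ℝ[X]) = (4⁻¹ : ℝ) • physHermite 2 + (2⁻¹ : ℝ) • 1 := by
    have h4 : (C 4⁻¹ : ℝ[X]) * 4 = 1 := by rw [← C_ofNat, ← C_mul]; norm_num
    have h2 : (C 2⁻¹ : ℝ[X]) = C 4⁻¹ * 2 := by rw [← C_ofNat, ← C_mul]; norm_num
    simp only [physHermite, smul_eq_C_mul, h2, mul_one, derivative_mul, derivative_sub,
      derivative_one, derivative_zero, derivative_X, derivative_ofNat]
    linear_combination (-X ^ 2 : ℝ[X]) * h4
  have hH₂ := gaussInt_physHermite_even_mul_unitHermite_sq 1 n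
  norm_num at hH₂
  rw [hX, add_mul, smul_mul_assoc, smul_mul_assoc, one_mul, map_add, map_smul, map_smul, hH₂,
    gaussInt_unitHermite_sq, smul_eq_mul, smul_eq_mul]
  ring

lemma gaussInt_derivative_sub_X_mul_sq (P : ℝ[X]) :
    gaussInt ((derivative P - X * P) ^ 2) =
      gaussInt (derivative P ^ 2) + gaussInt (P ^ 2) - gaussInt (X ^ 2 * P ^ 2) := by
  have hparts := gaussInt_two_X_mul_sub_derivative (X * P ^ 2)
  rw [← map_add, ← map_sub, ← add_zero (gaussInt (_ - _)), ← hparts, ← map_add]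
  simp only [derivative_mul, derivative_X, sq]
  ring_nf

/-! ### Hermite expansions -/

section InnerLp

variable {α : Type*} [MeasurableSpace α] {μ : Measure α}

lemma inner_Lp_eq_integral_mul (f g : Lp ℝ 2 μ) : inner ℝ f g = ∫ x, f x * g x ∂μ := by
  simp only [L2.inner_def, Real.inner_apply]

lemma inner_toLp_toLp {f g : α → ℝ} (hf : MemLp f 2 μ) (hg : MemLp g 2 μ) :
    inner ℝ (hf.toLp f) (hg.toLp g) = ∫ x, f x * g x ∂μ := by
  rw [inner_Lp_eq_integral_mul]
  exact integral_congr_ae (hf.coeFn_toLp.mul hg.coeFn_toLp)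

end InnerLp

/-- A polynomial, as an element of `L²(e^{-x^2} dx)`. -/
noncomputable def polyLp : ℝ[X] →ₗ[ℝ] Lp ℝ 2 hermiteMeasure where
  toFun P := (memLp_polynomial_hermiteMeasure P).toLp
  map_add' P Q := by
    rw [← MemLp.toLp_add]
    simp only [eval_add]
    rfl
  map_smul' a P := by
    rw [RingHom.id_apply, ← MemLp.toLp_const_smul]
    simp only [eval_smul]
    rfl

lemma inner_polyLp_polyLp (P Q : ℝ[X]) : inner ℝ (polyLp P) (polyLp Q) = gaussInt (P * Q) := by
  simp only [gaussInt_apply, eval_mul]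
  exact inner_toLp_toLp (memLp_polynomial_hermiteMeasure P) (memLp_polynomial_hermiteMeasure Q)

lemma inner_polyLp_toLp (P : ℝ[X]) {V : ℝ → ℝ} (hV : MemLp V 2 hermiteMeasure) :
    inner ℝ (polyLp P) (hV.toLp V) = ∫ x, P.eval x * V x ∂hermiteMeasure :=
  inner_toLp_toLp (memLp_polynomial_hermiteMeasure P) hV

lemma orthonormal_polyLp_unitHermite : Orthonormal ℝ fun n => polyLp (unitHermite n) :=
  orthonormal_iff_ite.2 fun m n => by
    rw [inner_polyLp_polyLp, gaussInt_unitHermite_mul_unitHermite]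

lemma eq_zero_of_forall_inner_polyLp_physHermite {f : Lp ℝ 2 hermiteMeasure}
    (h : ∀ n, inner ℝ (polyLp (physHermite n)) f = 0) : f = 0 := by
  have hpoly : (innerₛₗ ℝ f).comp polyLp = 0 := LinearMap.ext_on_range span_physHermite fun n => by
    simpa [real_inner_comm] using h n
  refine (Lp.eq_zero_iff_ae_eq_zero).2
    (hasExponentialMoments_hermiteMeasure.ae_eq_zero_of_forall_integral_pow_mul (Lp.memLp f)
      fun n => ?_)
  have hX := LinearMap.congr_fun hpoly (X ^ n)
  rw [LinearMap.comp_apply, innerₛₗ_apply_apply, real_inner_comm, LinearMap.zero_apply] at hX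
  rw [← Lp.toLp_coeFn f (Lp.memLp f), inner_polyLp_toLp] at hX
  simpa using hX

lemma eq_zero_of_forall_inner_polyLp_unitHermite {f : Lp ℝ 2 hermiteMeasure}
    (h : ∀ n, inner ℝ (polyLp (unitHermite n)) f = 0) : f = 0 :=
  eq_zero_of_forall_inner_polyLp_physHermite fun n => by
    have hn := h n
    rw [unitHermite, map_smul, real_inner_smul_left] at hn
    exact (mul_eq_zero.1 hn).resolve_left
      (inv_ne_zero (Real.sqrt_pos.2 (hermiteNormSq_pos n)).ne')

/-- The Hilbert basis of normalized Hermite polynomials of `L²(e^{-x^2} dx)`. -/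
noncomputable def hermiteBasis : HilbertBasis ℕ ℝ (Lp ℝ 2 hermiteMeasure) :=
  HilbertBasis.mkOfOrthogonalEqBot orthonormal_polyLp_unitHermite <|
    (Submodule.eq_bot_iff _).2 fun _ hf => eq_zero_of_forall_inner_polyLp_unitHermite fun n =>
      hf _ (Submodule.subset_span (Set.mem_range_self n))

lemma hermiteBasis_apply (n : ℕ) : hermiteBasis n = polyLp (unitHermite n) :=
  congrFun (HilbertBasis.coe_mkOfOrthogonalEqBot _ _) n

lemma hasHermiteExpansion_iff {V : ℝ → ℝ} {v : ℕ → ℝ} (hV : MemLp V 2 hermiteMeasure) :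
    HasHermiteExpansion V v ↔ Tendsto
      (fun N => ∑ j ∈ Finset.range N, v j • polyLp (physHermite j)) atTop (𝓝 (hV.toLp V)) := by
  simp only [← map_smul, ← map_sum]
  refine Iff.trans ?_ (Lp.tendsto_Lp_iff_tendsto_eLpNorm'' _
    (fun N => memLp_polynomial_hermiteMeasure _) V hV).symm
  simp only [eLpNorm_sub_comm _ V]
  simp only [HasHermiteExpansion, eval_finsetSum, eval_smul, smul_eq_mul]
  rfl

lemma exists_hasHermiteExpansion {V : ℝ → ℝ} (hV : MemLp V 2 hermiteMeasure) :
    ∃ v, HasHermiteExpansion V v := by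
  refine ⟨fun n => hermiteBasis.repr (hV.toLp V) n * (√(hermiteNormSq n))⁻¹,
    (hasHermiteExpansion_iff hV).2 ?_⟩
  refine (hermiteBasis.hasSum_repr (hV.toLp V)).tendsto_sum_nat.congr fun N =>
    Finset.sum_congr rfl fun n _ => ?_
  rw [hermiteBasis_apply, unitHermite, map_smul, smul_smul]

lemma HasHermiteExpansion.tendsto_sum_mul_gaussInt {V : ℝ → ℝ} {v : ℕ → ℝ}
    (h : HasHermiteExpansion V v) (hV : MemLp V 2 hermiteMeasure) (P : ℝ[X]) :
    Tendsto (fun N => ∑ j ∈ Finset.range N, v j * gaussInt (physHermite j * P)) atTop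
      (𝓝 (∫ x, V x * P.eval x ∂hermiteMeasure)) := by
  have hlim := (tendsto_const_nhds (x := polyLp P)).inner (𝕜 := ℝ)
    ((hasHermiteExpansion_iff hV).1 h)
  simp only [inner_polyLp_toLp, inner_sum, real_inner_smul_right, inner_polyLp_polyLp] at hlim
  simpa only [mul_comm] using hlim

/-! ### The bound as a sum of energies -/

/-- The energy `∫ |φ_k'|² + V |φ_k|²` of the `k`-th normalized Hermite function
`φ_k = unitHermite k · e^{-x²/2}`; the kinetic part is `k + 1/2`. -/
noncomputable def hermiteEnergy (V : ℝ → ℝ) (k : ℕ) : ℝ :=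
  ((k : ℝ) + 1 / 2) + ∫ x, V x * (unitHermite k ^ 2).eval x ∂hermiteMeasure

lemma sum_range_two_mul {M : Type*} [AddCommMonoid M] (f : ℕ → M) (h : ∀ r, f (2 * r + 1) = 0)
    (m : ℕ) : ∑ j ∈ Finset.range (2 * m), f j = ∑ r ∈ Finset.range m, f (2 * r) := by
  induction m with
  | zero => simp
  | succ m ih =>
    rw [mul_add_one, Finset.sum_range_succ, Finset.sum_range_succ, ih, h, add_zero,
      Finset.sum_range_succ]

lemma sum_range_choose_eq_choose_succ (n r : ℕ) :
    ∑ k ∈ Finset.range n, k.choose r = n.choose (r + 1) := by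
  induction n with
  | zero => simp
  | succ n ih => rw [Finset.sum_range_succ, ih, Nat.choose_succ_succ, add_comm]

lemma HasHermiteExpansion.integral_mul_unitHermite_sq {V : ℝ → ℝ} {v : ℕ → ℝ}
    (h : HasHermiteExpansion V v) (hV : MemLp V 2 hermiteMeasure) {k n : ℕ} (hk : k < n) :
    ∫ x, V x * (unitHermite k ^ 2).eval x ∂hermiteMeasure =
      ∑ r ∈ Finset.range n, 2 ^ r * (2 * r).factorial / r.factorial * k.choose r * v (2 * r) := by
  have hlim := (h.tendsto_sum_mul_gaussInt hV (unitHermite k ^ 2)).comp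
    (tendsto_id.const_mul_atTop' two_pos)
  refine tendsto_nhds_unique hlim (tendsto_const_nhds.congr' ?_)
  filter_upwards [eventually_ge_atTop n] with m hm
  simp only [Function.comp_apply, id]
  rw [sum_range_two_mul _ fun r => by rw [gaussInt_physHermite_odd_mul_unitHermite_sq, mul_zero]]
  simp only [gaussInt_physHermite_even_mul_unitHermite_sq, mul_comm (v _)]
  refine Finset.sum_subset (Finset.range_mono hm) fun r _ hr => ?_
  have hkr : k < r := hk.trans_le (by simpa using hr)
  rw [Nat.choose_eq_zero_of_lt hkr, Nat.cast_zero, mul_zero, zero_mul]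

lemma hermiteBound_eq_sum_hermiteEnergy {V : ℝ → ℝ} {v : ℕ → ℝ} (hV : MemLp V 2 hermiteMeasure)
    (h : HasHermiteExpansion V v) (n : ℕ) :
    hermiteBound v n = ∑ k ∈ Finset.range (n + 1), hermiteEnergy V k := by
  have hkinetic : ∑ k ∈ Finset.range (n + 1), ((k : ℝ) + 1 / 2) = ((n : ℝ) + 1) ^ 2 / 2 := by
    induction n with
    | zero => norm_num
    | succ n ih =>
      rw [Finset.sum_range_succ, ih]
      push_cast
      ring
  have hchoose (r : ℕ) :
      ∑ k ∈ Finset.range (n + 1), (k.choose r : ℝ) = ((n + 1).choose (r + 1) : ℝ) := by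
    exact_mod_cast sum_range_choose_eq_choose_succ (n + 1) r
  simp only [hermiteEnergy, Finset.sum_add_distrib, hkinetic, hermiteBound]
  rw [add_comm, Finset.sum_congr rfl fun k hk =>
    h.integral_mul_unitHermite_sq hV (Finset.mem_range.1 hk), Finset.sum_comm]
  simp only [← hchoose, Finset.mul_sum, Finset.sum_mul]

/-! ### Listing numbers with multiplicities -/

lemma nonempty_nat_orderIso {α : Type*} [LinearOrder α] [Infinite α]
    (h : ∀ a : α, (Set.Iic a).Finite) : Nonempty (ℕ ≃o α) := by
  classical
  let : LocallyFiniteOrder α := LocallyFiniteOrder.ofFiniteIcc fun a b =>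
    (h b).subset Set.Icc_subset_Iic_self
  have : NoMaxOrder α := ⟨fun a => by
    by_contra! hmax
    exact Set.infinite_univ ((h a).subset fun b _ => hmax b)⟩
  obtain ⟨a⟩ : Nonempty α := inferInstance
  obtain ⟨b, hb, hmin⟩ := Set.exists_min_image (Set.Iic a) id (h a) ⟨a, le_rfl⟩
  let : OrderBot α :=
    { bot := b
      bot_le := fun c => (le_total c a).elim (hmin c) (le_trans hb) }
  let : SuccOrder α := LinearLocallyFiniteOrder.succOrder α
  let : PredOrder α := LinearLocallyFiniteOrder.predOrder α
  exact ⟨orderIsoNatOfLinearSuccPredArch.symm⟩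

/-- `a 0 ≤ a 1 ≤ ⋯ → ∞` lists the real numbers `μ` with `d μ ≠ 0`, each of them `d μ` times. -/
structure IsMultiplicityListing (d : ℝ → ℕ) (a : ℕ → ℝ) : Prop where
  monotone : Monotone a
  tendsto : Tendsto a atTop atTop
  card_fiber : ∀ μ, Nat.card {k // a k = μ} = d μ

lemma finite_fiber_of_tendsto_atTop {a : ℕ → ℝ} (ha : Tendsto a atTop atTop) (μ : ℝ) :
    Finite {k // a k = μ} := by
  obtain ⟨N, hN⟩ := eventually_atTop.1 (ha.eventually_gt_atTop μ)
  exact (Set.finite_Iio N).subset fun k (hk : a k = μ) =>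
    not_le.1 fun hNk => (hN k hNk).ne' hk

lemma tendsto_atTop_of_monotone_of_finite {a : ℕ → ℝ} (ha : Monotone a)
    (hfin : ∀ R, {k | a k ≤ R}.Finite) : Tendsto a atTop atTop :=
  tendsto_atTop_atTop_of_monotone ha fun R => by
    by_contra! hlt
    exact Set.infinite_univ ((hfin R).subset fun k _ => (hlt k).le)

section Listing

variable {d : ℝ → ℕ}

/-- The pairs `(μ, i)` with `i < d μ`, ordered lexicographically. -/
abbrev MultiplicityIndex (d : ℝ → ℕ) : Type := {p : ℝ ×ₗ ℕ // (ofLex p).2 < d (ofLex p).1}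

namespace MultiplicityIndex

/-- The number a pair stands for. -/
def value (p : MultiplicityIndex d) : ℝ := (ofLex p.1).1

lemma monotone_value : Monotone (value : MultiplicityIndex d → ℝ) :=
  fun _ _ h => Prod.Lex.monotone_fst _ _ h

lemma finite_setOf_value_le (hfin : ∀ R : ℝ, {μ | μ ≤ R ∧ d μ ≠ 0}.Finite) (R : ℝ) :
    {p : MultiplicityIndex d | p.value ≤ R}.Finite := by
  refine Set.Finite.of_finite_image (f := Subtype.val) (Set.Finite.subset ((hfin R).biUnion
    fun μ _ => (Set.finite_Iio (d μ)).image fun i => toLex (μ, i)) ?_) Subtype.val_injective.injOn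
  rintro _ ⟨⟨p, hp⟩, hpR, rfl⟩
  simp only [Set.mem_iUnion, Set.mem_image]
  exact ⟨(ofLex p).1, ⟨hpR, by omega⟩, (ofLex p).2, hp, rfl⟩

lemma infinite (hinf : {μ | d μ ≠ 0}.Infinite) : Infinite (MultiplicityIndex d) := by
  by_contra hfin
  rw [not_infinite_iff_finite] at hfin
  exact hinf ((Set.finite_range value).subset fun μ hμ =>
    ⟨⟨toLex (μ, 0), Nat.pos_of_ne_zero hμ⟩, rfl⟩)

/-- The index within a fiber. -/
def fiberEquiv (μ : ℝ) : {p : MultiplicityIndex d // p.value = μ} ≃ Fin (d μ) where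
  toFun p := ⟨(ofLex p.1.1).2, by
    obtain ⟨⟨p, hp⟩, rfl⟩ := p
    exact hp⟩
  invFun i := ⟨⟨toLex (μ, i), i.2⟩, rfl⟩
  left_inv := by
    rintro ⟨p, rfl⟩
    rfl
  right_inv _ := rfl

end MultiplicityIndex

lemma exists_isMultiplicityListing (hfin : ∀ R : ℝ, {μ | μ ≤ R ∧ d μ ≠ 0}.Finite)
    (hinf : {μ | d μ ≠ 0}.Infinite) : ∃ a, IsMultiplicityListing d a := by
  have := MultiplicityIndex.infinite hinf
  have hvalue := MultiplicityIndex.finite_setOf_value_le hfin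
  obtain ⟨e⟩ := nonempty_nat_orderIso (α := MultiplicityIndex d) fun p =>
    (hvalue p.value).subset fun _ hq => MultiplicityIndex.monotone_value hq
  have hmono : Monotone fun k => (e k).value :=
    MultiplicityIndex.monotone_value.comp e.monotone
  refine ⟨fun k => (e k).value, hmono, tendsto_atTop_of_monotone_of_finite hmono fun R =>
    (hvalue R).preimage e.injective.injOn, fun μ => ?_⟩
  have fiber : {k // (e k).value = μ} ≃ Fin (d μ) :=
    (e.toEquiv.subtypeEquiv fun _ => Iff.rfl).trans (MultiplicityIndex.fiberEquiv μ)
  exact (Nat.card_congr fiber).trans (Nat.card_fin _)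

end Listing

/-! ### Compact symmetric operators -/

lemma finite_of_pairwise_le_dist {α ι : Type*} [PseudoMetricSpace α] {K : Set α}
    (hK : TotallyBounded K) {f : ι → α} (hf : ∀ i, f i ∈ K) {ε : ℝ} (hε : 0 < ε)
    (hdist : Pairwise fun i j => ε ≤ dist (f i) (f j)) : Finite ι := by
  obtain ⟨t, ht, hcover⟩ := Metric.totallyBounded_iff.1 hK (ε / 2) (half_pos hε)
  have hcenter (i : ι) : ∃ c ∈ t, dist (f i) c < ε / 2 := by simpa using hcover (hf i)
  choose c hct hc using hcenter
  have := ht.to_subtype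
  refine Finite.of_injective (fun i => (⟨c i, hct i⟩ : t)) fun i j hij => ?_
  by_contra hne
  have hcij : c i = c j := congrArg Subtype.val hij
  have hj := hc j
  rw [← hcij] at hj
  linarith [hdist hne, dist_triangle_right (f i) (f j) (c i), hc i]

section CompactOperator

variable {𝕜 E : Type*} [RCLike 𝕜] [NormedAddCommGroup E] [InnerProductSpace 𝕜 E] {T : E →L[𝕜] E}

open Module.End

/-- Images of unit eigenvectors for distinct eigenvalues `τ` are at mutual distance
`√(|τ|² + |τ'|²)`. -/
lemma finite_setOf_hasEigenvalue_of_le_norm (hT : IsCompactOperator T)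
    (hsymm : (T : E →ₗ[𝕜] E).IsSymmetric) {ε : ℝ} (hε : 0 < ε) :
    {τ : 𝕜 | ε ≤ ‖τ‖ ∧ HasEigenvalue (T : E →ₗ[𝕜] E) τ}.Finite := by
  obtain ⟨K, hK, hTK⟩ := hT.image_closedBall_subset_compact 1
  have hunit (τ : {τ : 𝕜 | ε ≤ ‖τ‖ ∧ HasEigenvalue (T : E →ₗ[𝕜] E) τ}) :
      ∃ v : eigenspace (T : E →ₗ[𝕜] E) (τ : 𝕜), ‖(v : E)‖ = 1 := by
    obtain ⟨w, hw, hw0⟩ := τ.2.2.exists_hasEigenvector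
    exact ⟨⟨_, Submodule.smul_mem _ (‖w‖ : 𝕜)⁻¹ hw⟩, norm_smul_inv_norm hw0⟩
  choose v hv using hunit
  have hTv (τ) : T (v τ) = (τ : 𝕜) • (v τ : E) := mem_eigenspace_iff.1 (v τ).2
  refine finite_of_pairwise_le_dist hK.totallyBounded (f := fun τ => T (v τ))
    (fun τ => hTK ⟨v τ, by simp [hv], rfl⟩) hε fun τ τ' hne => ?_
  have horth : inner 𝕜 (v τ : E) (v τ') = 0 :=
    hsymm.orthogonalFamily_eigenspaces (Subtype.coe_ne_coe.2 hne) _ _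
  beta_reduce
  rw [dist_eq_norm, hTv, hTv]
  refine le_of_sq_le_sq ?_ (norm_nonneg _)
  rw [@norm_sub_sq 𝕜, inner_smul_left, inner_smul_right, horth, norm_smul, norm_smul, hv, hv]
  simp only [mul_zero, map_zero, sub_zero, mul_one]
  have hτ : ε ≤ ‖(τ : 𝕜)‖ := τ.2.1
  nlinarith [sq_nonneg ‖(τ' : 𝕜)‖]

lemma infinite_setOf_hasEigenvalue [CompleteSpace E] (hT : IsCompactOperator T)
    (hsymm : (T : E →ₗ[𝕜] E).IsSymmetric)
    (hfin : ∀ τ, FiniteDimensional 𝕜 (eigenspace (T : E →ₗ[𝕜] E) τ))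
    (hE : ¬ FiniteDimensional 𝕜 E) : {τ : 𝕜 | HasEigenvalue (T : E →ₗ[𝕜] E) τ}.Infinite := by
  intro hev
  have : Finite {τ // eigenspace (T : E →ₗ[𝕜] E) τ ≠ ⊥} := hev
  have hsup := Submodule.finiteDimensional_iSup
    fun τ : {τ // eigenspace (T : E →ₗ[𝕜] E) τ ≠ ⊥} => eigenspace (T : E →ₗ[𝕜] E) (τ : 𝕜)
  rw [iSup_ne_bot_subtype] at hsup
  have htop := Submodule.orthogonal_eq_bot_iff.1
    (ContinuousLinearMap.orthogonalComplement_iSup_eigenspaces_eq_bot hT hsymm)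
  rw [htop] at hsup
  exact hE (LinearEquiv.finiteDimensional Submodule.topEquiv)

end CompactOperator

lemma exists_hilbertBasis_mem_of_card_fiber {𝕜 E ι κ : Type*} [RCLike 𝕜] [NormedAddCommGroup E]
    [InnerProductSpace 𝕜 E] [CompleteSpace E] {F : ι → Submodule 𝕜 E}
    [∀ i, FiniteDimensional 𝕜 (F i)] (horth : OrthogonalFamily 𝕜 (fun i => F i) fun i =>
      (F i).subtypeₗᵢ) (htotal : (⨆ i, F i)ᗮ = ⊥) (f : κ → ι) [∀ i, Finite {k // f k = i}]
    (hcard : ∀ i, Nat.card {k // f k = i} = Module.finrank 𝕜 (F i)) :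
    ∃ b : HilbertBasis κ 𝕜 E, ∀ k, b k ∈ F (f k) := by
  let index (i : ι) : {k // f k = i} ≃ Fin (Module.finrank 𝕜 (F i)) :=
    Finite.equivFinOfCardEq (hcard i)
  have (i : ι) : Fintype {k // f k = i} := Fintype.ofFinite _
  let e (i : ι) : OrthonormalBasis {k // f k = i} 𝕜 (F i) :=
    (stdOrthonormalBasis 𝕜 (F i)).reindex (index i).symm
  let v (k : κ) : E := e (f k) ⟨k, rfl⟩
  have hv (i : ι) (k : {k // f k = i}) : v k = e i k := by
    obtain ⟨k, rfl⟩ := k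
    rfl
  have hvon : Orthonormal 𝕜 v :=
    (horth.orthonormal_sigma_orthonormal fun i => (e i).orthonormal).comp
      (fun k => (⟨f k, k, rfl⟩ : Σ i, {k // f k = i})) fun _ _ hkl =>
        congrArg (fun p : Σ i, {k // f k = i} => (p.2 : κ)) hkl
  refine ⟨HilbertBasis.mkOfOrthogonalEqBot hvon (eq_bot_mono (Submodule.orthogonal_le
    (iSup_le fun i x hx => ?_)) htotal), fun k => ?_⟩
  · have hx_sum : ∑ k, (((e i).repr ⟨x, hx⟩ k • e i k : F i) : E) = x := by
      rw [← Submodule.coe_sum, (e i).sum_repr]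
    rw [← hx_sum]
    refine Submodule.sum_mem _ fun k _ => ?_
    rw [Submodule.coe_smul, ← hv]
    exact Submodule.smul_mem _ _ (Submodule.subset_span ⟨k, rfl⟩)
  · rw [HilbertBasis.coe_mkOfOrthogonalEqBot]
    exact (e (f k) ⟨k, rfl⟩).2

/-! ### The variational principle for sums of eigenvalues -/

lemma sum_range_le_of_hasSum_weights {a w : ℕ → ℝ} (ha : Monotone a) (hw0 : ∀ j, 0 ≤ w j)
    (hw1 : ∀ j, w j ≤ 1) {n : ℕ} (hw : HasSum w n) {Q : ℝ}
    (hQ : ∀ N, ∑ j ∈ Finset.range N, a j * w j ≤ Q) : ∑ j ∈ Finset.range n, a j ≤ Q := by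
  have hshift : ∀ N ≥ n,
      ∑ j ∈ Finset.range n, (a j - a n) + a n * ∑ j ∈ Finset.range N, w j ≤ Q := by
    intro N hN
    have hle : ∑ j ∈ Finset.range n, (a j - a n) ≤ ∑ j ∈ Finset.range N, (a j - a n) * w j :=
      calc
        ∑ j ∈ Finset.range n, (a j - a n)
          ≤ ∑ j ∈ Finset.range n, (a j - a n) * w j := Finset.sum_le_sum fun j hj => by
            have := ha (Finset.mem_range.1 hj).le
            nlinarith [hw1 j]
        _ ≤ ∑ j ∈ Finset.range N, (a j - a n) * w j :=
            Finset.sum_le_sum_of_subset_of_nonneg (Finset.range_mono hN) fun j _ hj =>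
              mul_nonneg (sub_nonneg.2 (ha (by simpa using hj))) (hw0 j)
    simp only [sub_mul, Finset.sum_sub_distrib, ← Finset.mul_sum] at hle ⊢
    linarith [hQ N]
  have hlim := le_of_tendsto ((hw.tendsto_sum_nat.const_mul (a n)).const_add
    (∑ j ∈ Finset.range n, (a j - a n))) (eventually_atTop.2 ⟨n, hshift⟩)
  simp only [Finset.sum_sub_distrib, Finset.sum_const, Finset.card_range, nsmul_eq_mul] at hlim
  linarith

section Form

variable {H L : Type*} [NormedAddCommGroup H] [InnerProductSpace ℝ H] [NormedAddCommGroup L]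
  [InnerProductSpace ℝ L]

/-- The weight of `b j` is `∑ i < n, ⟪b j, φ i⟫²`, at most `1` by Bessel's inequality. -/
lemma sum_range_le_sum_range_of_orthonormal (b : HilbertBasis ℕ ℝ L) {a : ℕ → ℝ}
    (ha : Monotone a) {φ : ℕ → L} (hφ : Orthonormal ℝ φ) {q : ℕ → ℝ}
    (hq : ∀ i N, ∑ j ∈ Finset.range N, a j * inner ℝ (b j) (φ i) ^ 2 ≤ q i) (n : ℕ) :
    ∑ j ∈ Finset.range n, a j ≤ ∑ i ∈ Finset.range n, q i := by
  refine sum_range_le_of_hasSum_weights ha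
    (w := fun j => ∑ i ∈ Finset.range n, inner ℝ (b j) (φ i) ^ 2)
    (fun j => Finset.sum_nonneg fun i _ => sq_nonneg _) (fun j => ?_) ?_ fun N => ?_
  · have hbessel := hφ.sum_inner_products_le (b j) (s := Finset.range n)
    simpa [b.orthonormal.1 j, real_inner_comm] using hbessel
  · have hparseval (i : ℕ) : HasSum (fun j => inner ℝ (b j) (φ i) ^ 2) 1 := by
      simpa [hφ.1 i, real_inner_comm, sq] using b.hasSum_inner_mul_inner (φ i) (φ i)
    simpa using hasSum_sum (s := Finset.range n) fun i _ => hparseval i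
  · simp only [Finset.mul_sum]
    rw [Finset.sum_comm]
    exact Finset.sum_le_sum fun i _ => hq i N

variable {B : H →L[ℝ] H →L[ℝ] ℝ} {J : H →L[ℝ] L}

/-- `B (k - p) (k - p) ≥ 0` for the projection `p` of `k` onto the span of the `h j`. -/
lemma sum_mul_inner_sq_le (hsymm : ∀ x y, B x y = B y x) (hpos : ∀ x, 0 ≤ B x x) {a : ℕ → ℝ}
    {h : ℕ → H} (hJ : Orthonormal ℝ fun j => J (h j))
    (hB : ∀ j k, B (h j) k = a j * inner ℝ (J (h j)) (J k)) (k : H) (N : ℕ) :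
    ∑ j ∈ Finset.range N, a j * inner ℝ (J (h j)) (J k) ^ 2 ≤ B k k := by
  let p := ∑ j ∈ Finset.range N, inner ℝ (J (h j)) (J k) • h j
  have form_p (y : H) : B p y =
      ∑ j ∈ Finset.range N, a j * (inner ℝ (J (h j)) (J k) * inner ℝ (J (h j)) (J y)) := by
    simp only [p, map_sum, map_smul, _root_.sum_apply, _root_.smul_apply, hB, smul_eq_mul]
    exact Finset.sum_congr rfl fun j _ => by ring
  have inner_p {j : ℕ} (hj : j ∈ Finset.range N) :
      inner ℝ (J (h j)) (J p) = inner ℝ (J (h j)) (J k) := by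
    simp only [p, map_sum, map_smul]
    exact hJ.inner_right_sum _ hj
  have form_p_p : B p p = B p k := by
    rw [form_p, form_p]
    exact Finset.sum_congr rfl fun j hj => by rw [inner_p hj]
  have hsub := hpos (k - p)
  simp only [map_sub, _root_.sub_apply, hsymm k p, form_p_p] at hsub
  rw [form_p] at hsub
  simp only [sq]
  linarith

/-- A bounded symmetric coercive form `B` on `H` together with a compact embedding `J` of `H` onto
a dense subspace of `L`: the closed form of a positive operator on `L` with compact resolvent. -/
structure IsCompactForm (B : H →L[ℝ] H →L[ℝ] ℝ) (J : H →L[ℝ] L) : Prop where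
  symm : ∀ x y, B x y = B y x
  coercive : IsCoercive B
  isCompactOperator : IsCompactOperator J
  denseRange : DenseRange J

/-- The solutions `x` of the weak eigenvalue equation `B x k = α ⟪J x, J k⟫` for all `k`. -/
def formEigenspace (B : H →L[ℝ] H →L[ℝ] ℝ) (J : H →L[ℝ] L) (α : ℝ) : Submodule ℝ H where
  carrier := {x | ∀ k, B x k = α * inner ℝ (J x) (J k)}
  add_mem' hx hy k := by
    simp only [map_add, _root_.add_apply, inner_add_left, hx k, hy k, mul_add]
  zero_mem' k := by simp
  smul_mem' c x hx k := by
    simp only [map_smul, _root_.smul_apply, real_inner_smul_left, hx k, smul_eq_mul]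
    ring

lemma mem_formEigenspace {α : ℝ} {x : H} :
    x ∈ formEigenspace B J α ↔ ∀ k, B x k = α * inner ℝ (J x) (J k) := Iff.rfl

lemma sum_range_le_sum_range_form (hsymm : ∀ x y, B x y = B y x) (hpos : ∀ x, 0 ≤ B x x)
    {a : ℕ → ℝ} (ha : Monotone a) {x w : ℕ → H} (hx : ∀ k, x k ∈ formEigenspace B J (a k))
    (b : HilbertBasis ℕ ℝ L) (hb : ∀ k, J (x k) = b k) (hw : Orthonormal ℝ fun i => J (w i))
    (n : ℕ) : ∑ k ∈ Finset.range n, a k ≤ ∑ k ∈ Finset.range n, B (w k) (w k) := by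
  refine sum_range_le_sum_range_of_orthonormal b ha hw (fun i N => ?_) n
  simp only [← hb]
  exact sum_mul_inner_sq_le hsymm hpos (by simpa only [hb] using b.orthonormal)
    (fun j => mem_formEigenspace.1 (hx j)) (w i) N

namespace IsCompactForm

lemma form_self_pos (hB : IsCompactForm B J) {x : H} (hx : x ≠ 0) : 0 < B x x := by
  obtain ⟨C, hC, hcoercive⟩ := hB.coercive
  have := norm_pos_iff.2 hx
  exact lt_of_lt_of_le (by positivity) (hcoercive x)

lemma form_self_nonneg (hB : IsCompactForm B J) (x : H) : 0 ≤ B x x := by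
  rcases eq_or_ne x 0 with rfl | hx
  · simp
  · exact (hB.form_self_pos hx).le

lemma eq_of_form_eq (hB : IsCompactForm B J) {x y : H} (hxy : ∀ k, B x k = B y k) : x = y := by
  by_contra hne
  refine (hB.form_self_pos (sub_ne_zero.2 hne)).ne' ?_
  rw [map_sub B, _root_.sub_apply, hxy, sub_self]

lemma pos_of_finrank_formEigenspace_ne_zero (hB : IsCompactForm B J) {α : ℝ}
    (hα : Module.finrank ℝ (formEigenspace B J α) ≠ 0) : 0 < α := by
  obtain ⟨x, hx, hx0⟩ := (Submodule.ne_bot_iff _).1 fun hbot : formEigenspace B J α = ⊥ =>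
    hα (by rw [hbot, finrank_bot])
  have hpos := hB.form_self_pos hx0
  rw [mem_formEigenspace.1 hx] at hpos
  exact pos_of_mul_pos_left hpos real_inner_self_nonneg

variable [CompleteSpace H] [CompleteSpace L]

/-- The solution `x` of `B x k = ⟪f, J k⟫` for all `k`, given by the Lax–Milgram theorem. -/
noncomputable def solution (hB : IsCompactForm B J) : L →L[ℝ] H :=
  (hB.coercive.continuousLinearEquivOfBilin.symm : H →L[ℝ] H) ∘L ContinuousLinearMap.adjoint J

lemma form_solution (hB : IsCompactForm B J) (f : L) (k : H) :
    B (hB.solution f) k = inner ℝ f (J k) := by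
  rw [← hB.coercive.continuousLinearEquivOfBilin_apply]
  simp [solution, ContinuousLinearMap.adjoint_inner_left]

lemma solution_ne_zero (hB : IsCompactForm B J) {f : L} (hf : f ≠ 0) : hB.solution f ≠ 0 := by
  contrapose! hf
  refine hB.denseRange.eq_zero_of_inner_left ℝ fun k => ?_
  rw [← hB.form_solution, hf, map_zero, _root_.zero_apply]

/-- The inverse of the operator on `L` whose form is `B`. -/
noncomputable def resolvent (hB : IsCompactForm B J) : L →L[ℝ] L := J ∘L hB.solution

lemma resolvent_apply (hB : IsCompactForm B J) (f : L) : hB.resolvent f = J (hB.solution f) := rfl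

lemma isCompactOperator_resolvent (hB : IsCompactForm B J) : IsCompactOperator hB.resolvent :=
  hB.isCompactOperator.comp_clm hB.solution

lemma isSymmetric_resolvent (hB : IsCompactForm B J) :
    (hB.resolvent : L →ₗ[ℝ] L).IsSymmetric := fun f g => by
  change inner ℝ (J (hB.solution f)) g = inner ℝ f (J (hB.solution g))
  rw [real_inner_comm, ← hB.form_solution, ← hB.form_solution, hB.symm]

lemma resolvent_eq_zero_iff (hB : IsCompactForm B J) {f : L} : hB.resolvent f = 0 ↔ f = 0 := by
  refine ⟨fun hf => ?_, fun hf => by rw [hf, map_zero]⟩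
  by_contra hne
  refine (hB.form_self_pos (hB.solution_ne_zero hne)).ne' ?_
  rw [hB.form_solution, ← hB.resolvent_apply, hf, inner_zero_right]

open Module.End

lemma smul_resolvent_of_mem_eigenspace (hB : IsCompactForm B J) {α : ℝ} {f : L}
    (hf : f ∈ eigenspace (hB.resolvent : L →ₗ[ℝ] L) α⁻¹) : α • hB.resolvent f = f := by
  have hTf : hB.resolvent f = α⁻¹ • f := mem_eigenspace_iff.1 hf
  rcases eq_or_ne α 0 with rfl | hα
  · rw [inv_zero, zero_smul, hB.resolvent_eq_zero_iff] at hTf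
    rw [hTf, map_zero, smul_zero]
  · rw [hTf, smul_inv_smul₀ hα]

lemma smul_solution_of_mem_formEigenspace (hB : IsCompactForm B J) {α : ℝ} {x : H}
    (hx : x ∈ formEigenspace B J α) : α • hB.solution (J x) = x :=
  hB.eq_of_form_eq fun k => by
    rw [map_smul, _root_.smul_apply, hB.form_solution, smul_eq_mul, mem_formEigenspace.1 hx]

/-- The form eigenspace at `α`, viewed in `L`, is the eigenspace of the resolvent at `α⁻¹`; both
vanish at the junk value `0⁻¹ = 0`. -/
noncomputable def formEigenspaceEquiv (hB : IsCompactForm B J) (α : ℝ) :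
    formEigenspace B J α ≃ₗ[ℝ] eigenspace (hB.resolvent : L →ₗ[ℝ] L) α⁻¹ where
  toFun x := ⟨J x, mem_eigenspace_iff.2 <| by
    rw [ContinuousLinearMap.coe_coe, hB.resolvent_apply]
    rcases eq_or_ne α 0 with rfl | hα
    · have hx := hB.smul_solution_of_mem_formEigenspace x.2
      rw [zero_smul] at hx
      simp [← hx]
    · conv_rhs => rw [← hB.smul_solution_of_mem_formEigenspace x.2]
      rw [map_smul, inv_smul_smul₀ hα]⟩
  map_add' x y := Subtype.ext (map_add J (x : H) y)
  map_smul' c x := Subtype.ext (map_smul J c (x : H))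
  invFun f := ⟨α • hB.solution f, mem_formEigenspace.2 fun k => by
    rw [map_smul J, ← hB.resolvent_apply, hB.smul_resolvent_of_mem_eigenspace f.2, map_smul,
      _root_.smul_apply, hB.form_solution, smul_eq_mul]⟩
  left_inv x := Subtype.ext (hB.smul_solution_of_mem_formEigenspace x.2)
  right_inv f := Subtype.ext <| by
    change J (α • hB.solution f) = f
    rw [map_smul, ← hB.resolvent_apply, hB.smul_resolvent_of_mem_eigenspace f.2]

lemma finiteDimensional_eigenspace_resolvent (hB : IsCompactForm B J) (τ : ℝ) :
    FiniteDimensional ℝ (eigenspace (hB.resolvent : L →ₗ[ℝ] L) τ) := by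
  rcases eq_or_ne τ 0 with rfl | hτ
  · have hbot : eigenspace (hB.resolvent : L →ₗ[ℝ] L) 0 = ⊥ := by
      rw [eigenspace_zero, LinearMap.ker_eq_bot']
      exact fun f => hB.resolvent_eq_zero_iff.1
    rw [hbot]
    infer_instance
  · exact ContinuousLinearMap.finite_dimensional_eigenspace hB.isCompactOperator_resolvent τ hτ

lemma finiteDimensional_formEigenspace (hB : IsCompactForm B J) (α : ℝ) :
    FiniteDimensional ℝ (formEigenspace B J α) :=
  have := hB.finiteDimensional_eigenspace_resolvent α⁻¹
  (hB.formEigenspaceEquiv α).symm.finiteDimensional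

lemma finrank_formEigenspace_ne_zero_iff (hB : IsCompactForm B J) {α : ℝ} :
    Module.finrank ℝ (formEigenspace B J α) ≠ 0 ↔
      HasEigenvalue (hB.resolvent : L →ₗ[ℝ] L) α⁻¹ := by
  have := hB.finiteDimensional_eigenspace_resolvent α⁻¹
  rw [(hB.formEigenspaceEquiv α).finrank_eq, Ne, Submodule.finrank_eq_zero]
  exact hasEigenvalue_iff.symm

lemma exists_isMultiplicityListing (hB : IsCompactForm B J) (hL : ¬ FiniteDimensional ℝ L) :
    ∃ a, IsMultiplicityListing (fun α => Module.finrank ℝ (formEigenspace B J α)) a := by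
  refine _root_.exists_isMultiplicityListing (fun R => ?_) ?_
  · have hfin := finite_setOf_hasEigenvalue_of_le_norm hB.isCompactOperator_resolvent
      hB.isSymmetric_resolvent (ε := (max R 1)⁻¹) (by positivity)
    refine (hfin.preimage (f := Inv.inv) inv_injective.injOn).subset fun α hα => ?_
    have hpos := hB.pos_of_finrank_formEigenspace_ne_zero hα.2
    refine ⟨?_, hB.finrank_formEigenspace_ne_zero_iff.1 hα.2⟩
    rw [Real.norm_of_nonneg (inv_pos.2 hpos).le]
    exact inv_anti₀ hpos (hα.1.trans (le_max_left _ _))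
  · have hinf := infinite_setOf_hasEigenvalue hB.isCompactOperator_resolvent
      hB.isSymmetric_resolvent hB.finiteDimensional_eigenspace_resolvent hL
    refine Set.Infinite.of_image Inv.inv (hinf.mono fun τ hτ => ⟨τ⁻¹, ?_, inv_inv τ⟩)
    exact hB.finrank_formEigenspace_ne_zero_iff.2 (by rwa [inv_inv])

lemma exists_hilbertBasis_mem_eigenspace (hB : IsCompactForm B J) {a : ℕ → ℝ}
    (ha : IsMultiplicityListing (fun α => Module.finrank ℝ (formEigenspace B J α)) a) :
    ∃ b : HilbertBasis ℕ ℝ L, ∀ k, b k ∈ eigenspace (hB.resolvent : L →ₗ[ℝ] L) (a k)⁻¹ := by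
  have (α : ℝ) := hB.finiteDimensional_eigenspace_resolvent α⁻¹
  have := finite_fiber_of_tendsto_atTop ha.tendsto
  refine exists_hilbertBasis_mem_of_card_fiber
    (F := fun α : ℝ => eigenspace (hB.resolvent : L →ₗ[ℝ] L) α⁻¹)
    (hB.isSymmetric_resolvent.orthogonalFamily_eigenspaces.comp inv_injective) ?_ a fun α => ?_
  · rw [inv_surjective.iSup_comp]
    exact ContinuousLinearMap.orthogonalComplement_iSup_eigenspaces_eq_bot
      hB.isCompactOperator_resolvent hB.isSymmetric_resolvent
  · rw [ha.card_fiber, (hB.formEigenspaceEquiv α).finrank_eq]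

lemma exists_hilbertBasis_formEigenspace (hB : IsCompactForm B J) {a : ℕ → ℝ}
    (ha : IsMultiplicityListing (fun α => Module.finrank ℝ (formEigenspace B J α)) a) :
    ∃ (b : HilbertBasis ℕ ℝ L) (x : ℕ → H),
      ∀ k, x k ∈ formEigenspace B J (a k) ∧ J (x k) = b k := by
  obtain ⟨b, hb⟩ := hB.exists_hilbertBasis_mem_eigenspace ha
  let e (k : ℕ) := hB.formEigenspaceEquiv (a k)
  exact ⟨b, fun k => (e k).symm ⟨b k, hb k⟩, fun k => ⟨((e k).symm ⟨b k, hb k⟩).2,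
    congrArg Subtype.val ((e k).apply_symm_apply ⟨b k, hb k⟩)⟩⟩

end IsCompactForm

end Form

/-! ### Absolutely continuous and square integrable functions on the line -/

lemma intervalIntegrable_of_locallyIntegrable {f : ℝ → ℝ} (hf : LocallyIntegrable f volume)
    (a b : ℝ) : IntervalIntegrable f volume a b :=
  (hf.integrableOn_isCompact isCompact_uIcc).intervalIntegrable

lemma locallyIntegrable_Lp (g : ℝ →₂[volume] ℝ) : LocallyIntegrable g volume :=
  (Lp.memLp g).locallyIntegrable (by norm_num)

lemma continuous_of_absolutelyContinuousOnInterval {f : ℝ → ℝ}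
    (hf : ∀ a b, AbsolutelyContinuousOnInterval f a b) : Continuous f :=
  continuous_iff_continuousAt.2 fun x => (hf (x - 1) (x + 1)).continuousOn.continuousAt (by
    rw [Set.uIcc_of_le (by linarith)]
    exact Icc_mem_nhds (by linarith) (by linarith))

lemma integral_eq_sub_of_absolutelyContinuousOnInterval {f f' : ℝ → ℝ} {a b : ℝ}
    (hf : AbsolutelyContinuousOnInterval f a b) (hf' : ∀ᵐ x, HasDerivAt f (f' x) x) :
    ∫ x in a..b, f' x = f b - f a := by
  rw [← hf.integral_deriv_eq_sub]
  exact intervalIntegral.integral_congr_ae (hf'.mono fun x hx _ => hx.deriv.symm)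

lemma integral_eq_zero_of_absolutelyContinuousOnInterval {f f' : ℝ → ℝ}
    (hf : ∀ a b, AbsolutelyContinuousOnInterval f a b) (hf' : ∀ᵐ x, HasDerivAt f (f' x) x)
    (hfi : Integrable f) (hfi' : Integrable f') : ∫ x, f' x = 0 := by
  have hlim : Tendsto (fun x => f x - f (-x)) atTop (𝓝 (∫ x, f' x)) := by
    simpa only [integral_eq_sub_of_absolutelyContinuousOnInterval (hf _ _) hf', id_eq] using
      intervalIntegral_tendsto_integral hfi' tendsto_neg_atTop_atBot tendsto_id
  refine ((hfi.sub hfi.comp_neg).integrableAtFilter atTop).eq_zero_of_tendsto (fun s hs => ?_) hlim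
  obtain ⟨b, hb⟩ := mem_atTop_sets.1 hs
  exact measure_mono_top hb Real.volume_Ici

/-- The function with value `c` at zero and derivative `g`. -/
noncomputable def primitive (c : ℝ) (g : ℝ → ℝ) (x : ℝ) : ℝ := c + ∫ t in (0 : ℝ)..x, g t

section Primitive

variable {g : ℝ → ℝ} (hg : LocallyIntegrable g volume) (c : ℝ)

include hg

lemma primitive_sub (x y : ℝ) : primitive c g x - primitive c g y = ∫ t in y..x, g t := by
  rw [primitive, primitive, add_sub_add_left_eq_sub]
  exact intervalIntegral.integral_interval_sub_left (intervalIntegrable_of_locallyIntegrable hg 0 x)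
    (intervalIntegrable_of_locallyIntegrable hg 0 y)

lemma continuous_primitive : Continuous (primitive c g) :=
  continuous_const.add
    (intervalIntegral.continuous_primitive (intervalIntegrable_of_locallyIntegrable hg) 0)

lemma absolutelyContinuousOnInterval_primitive (a b : ℝ) :
    AbsolutelyContinuousOnInterval (primitive c g) a b := by
  have hle : min (min a b) 0 ≤ max (max a b) 0 := (min_le_right _ _).trans (le_max_right _ _)
  have hint : AbsolutelyContinuousOnInterval (fun x => ∫ t in (0 : ℝ)..x, g t)
      (min (min a b) 0) (max (max a b) 0) :=
    (intervalIntegrable_of_locallyIntegrable hg _ _)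
      |>.absolutelyContinuousOnInterval_intervalIntegral (by rw [Set.uIcc_of_le hle]; simp)
  refine contDiffOn_const.absolutelyContinuousOnInterval.add (hint.mono ?_)
  rw [Set.uIcc_of_le hle]
  exact Set.Icc_subset_Icc (min_le_left _ _) (le_max_left _ _)

lemma ae_hasDerivAt_primitive : ∀ᵐ x, HasDerivAt (primitive c g) (g x) x := by
  filter_upwards [_root_.LocallyIntegrable.ae_hasDerivAt_integral hg] with x hx
  exact (hx 0).const_add c

end Primitive

lemma primitive_congr_ae {f g : ℝ → ℝ} (h : f =ᵐ[volume] g) (c : ℝ) :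
    primitive c f = primitive c g := by
  funext x
  rw [primitive, primitive, intervalIntegral.integral_congr_ae (h.mono fun y hy _ => hy)]

lemma norm_sq_Lp (f : ℝ →₂[volume] ℝ) : ‖f‖ ^ 2 = ∫ x, f x ^ 2 := by
  rw [← real_inner_self_eq_norm_sq, inner_Lp_eq_integral_mul]
  simp only [sq]

lemma integrable_mul_Lp (f g : ℝ →₂[volume] ℝ) : Integrable fun x => f x * g x :=
  (Lp.memLp f).integrable_mul (Lp.memLp g)

lemma setIntegral_Ioc_sq_le (g : ℝ →₂[volume] ℝ) (a b : ℝ) :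
    (∫ t in Set.Ioc a b, g t) ^ 2 ≤ |b - a| * ‖g‖ ^ 2 := by
  rw [← L2.inner_indicatorConstLp_one (𝕜 := ℝ) measurableSet_Ioc measure_Ioc_lt_top.ne g, sq]
  refine (real_inner_mul_inner_self_le _ g).trans ?_
  rw [L2.real_inner_indicatorConstLp_one_indicatorConstLp_one measurableSet_Ioc measurableSet_Ioc
    measure_Ioc_lt_top.ne measure_Ioc_lt_top.ne, Set.inter_self, Real.volume_real_Ioc,
    real_inner_self_eq_norm_sq]
  gcongr
  exact max_le (le_abs_self _) (abs_nonneg _)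

lemma sq_intervalIntegral_le (g : ℝ →₂[volume] ℝ) (a b : ℝ) :
    (∫ t in a..b, g t) ^ 2 ≤ |b - a| * ‖g‖ ^ 2 := by
  rcases le_total a b with hab | hba
  · rw [intervalIntegral.integral_of_le hab]
    exact setIntegral_Ioc_sq_le g a b
  · rw [intervalIntegral.integral_of_ge hba, neg_sq, abs_sub_comm]
    exact setIntegral_Ioc_sq_le g b a

lemma tendsto_intervalIntegral_Lp (a b : ℝ) {ι : Type*} {l : Filter ι} {g : ι → ℝ →₂[volume] ℝ}
    {g' : ℝ →₂[volume] ℝ} (hg : Tendsto g l (𝓝 g')) :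
    Tendsto (fun i => ∫ t in a..b, g i t) l (𝓝 (∫ t in a..b, g' t)) := by
  have hset : ∀ a b : ℝ, Tendsto (fun i => ∫ t in Set.Ioc a b, g i t) l
      (𝓝 (∫ t in Set.Ioc a b, g' t)) := fun a b => by
    simp only [← L2.inner_indicatorConstLp_one (𝕜 := ℝ) measurableSet_Ioc measure_Ioc_lt_top.ne]
    exact ((continuous_const.inner continuous_id).tendsto g').comp hg
  exact (hset a b).sub (hset b a)

/-- The mean of `u ^ 2` over `[x, x + δ]` is at most `‖u‖ ^ 2 / δ`, so it suffices to bound the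
increment of `u` from a point at which `u ^ 2` does not exceed its mean. -/
lemma sq_primitive_le {c : ℝ} {u g : ℝ →₂[volume] ℝ} (h : u =ᵐ[volume] primitive c g) (x : ℝ)
    {δ : ℝ} (hδ : 0 < δ) :
    primitive c g x ^ 2 ≤ 2 / δ * ‖u‖ ^ 2 + 2 * δ * ‖g‖ ^ 2 := by
  have hint : Integrable fun y => primitive c g y ^ 2 :=
    ((Lp.memLp u).ae_eq h).integrable_sq
  obtain ⟨y, hy, hmean⟩ := exists_le_setAverage (μ := volume) (s := Set.Icc x (x + δ))
    (by simp [hδ]) (by simp) hint.integrableOn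
  have hyx : |x - y| ≤ δ := abs_le.2 ⟨by linarith [hy.2], by linarith [hy.1]⟩
  have hu : primitive c g y ^ 2 ≤ ‖u‖ ^ 2 / δ := by
    refine hmean.trans ?_
    rw [setAverage_eq, Real.volume_real_Icc_of_le (by linarith), add_sub_cancel_left, smul_eq_mul,
      ← div_eq_inv_mul, norm_sq_Lp,
      integral_congr_ae (h.mono fun y hy => congrArg (· ^ 2) hy)]
    exact div_le_div_of_nonneg_right
      (setIntegral_le_integral hint (Eventually.of_forall fun y => sq_nonneg _)) hδ.le
  have hg : (primitive c g x - primitive c g y) ^ 2 ≤ δ * ‖g‖ ^ 2 := by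
    rw [primitive_sub (locallyIntegrable_Lp g)]
    exact (sq_intervalIntegral_le g y x).trans (by gcongr)
  calc primitive c g x ^ 2
      = (primitive c g y + (primitive c g x - primitive c g y)) ^ 2 := by ring
    _ ≤ 2 * (primitive c g y ^ 2 + (primitive c g x - primitive c g y) ^ 2) := add_sq_le
    _ ≤ 2 * (‖u‖ ^ 2 / δ + δ * ‖g‖ ^ 2) := by gcongr
    _ = 2 / δ * ‖u‖ ^ 2 + 2 * δ * ‖g‖ ^ 2 := by ring

lemma ae_eq_mul_of_tendsto {p : ℝ → ℝ} {f g : ℕ → ℝ →₂[volume] ℝ} {f' g' : ℝ →₂[volume] ℝ}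
    (hf : Tendsto f atTop (𝓝 f')) (hg : Tendsto g atTop (𝓝 g'))
    (h : ∀ n, ∀ᵐ x, g n x = p x * f n x) : ∀ᵐ x, g' x = p x * f' x := by
  obtain ⟨s, hs, hfs⟩ := (tendstoInMeasure_of_tendsto_Lp hf).exists_seq_tendsto_ae
  obtain ⟨t, ht, hgt⟩ := (tendstoInMeasure_of_tendsto_Lp
    (hg.comp hs.tendsto_atTop)).exists_seq_tendsto_ae
  filter_upwards [hfs, hgt, ae_all_iff.2 h] with x hfx hgx hx
  refine tendsto_nhds_unique hgx ?_
  simp only [Function.comp_apply, hx]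
  exact (hfx.comp ht.tendsto_atTop).const_mul _

lemma ae_eq_primitive_of_tendsto {f g : ℕ → ℝ →₂[volume] ℝ} {f' g' : ℝ →₂[volume] ℝ}
    (hf : Tendsto f atTop (𝓝 f')) (hg : Tendsto g atTop (𝓝 g'))
    (h : ∀ n, ∃ c, ∀ᵐ x, f n x = primitive c (g n) x) :
    ∃ c, ∀ᵐ x, f' x = primitive c g' x := by
  choose c hc using h
  obtain ⟨s, hs, hfs⟩ := (tendstoInMeasure_of_tendsto_Lp hf).exists_seq_tendsto_ae
  have hlim : ∀ᵐ x, Tendsto (fun n => c (s n)) atTop (𝓝 (f' x - ∫ t in (0 : ℝ)..x, g' t)) := by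
    filter_upwards [hfs, ae_all_iff.2 hc] with x hfx hcx
    refine (hfx.sub ((tendsto_intervalIntegral_Lp 0 x hg).comp hs.tendsto_atTop)).congr fun n => ?_
    simp only [hcx, primitive, Function.comp_apply, add_sub_cancel_right]
  obtain ⟨x₀, hx₀⟩ := hlim.exists
  refine ⟨f' x₀ - ∫ t in (0 : ℝ)..x₀, g' t, ?_⟩
  filter_upwards [hlim] with x hx
  rw [primitive, tendsto_nhds_unique hx₀ hx, sub_add_cancel]

/-! ### Confining potentials and their form domains -/

/-- A confining potential: locally integrable, and tending to infinity at both ends of the line. -/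
structure IsConfining (V : ℝ → ℝ) : Prop where
  locallyIntegrable : LocallyIntegrable V volume
  tendsto : Tendsto V (cocompact ℝ) atTop

lemma isConfining_of_memLp {V : ℝ → ℝ} (hV : MemLp V 2 hermiteMeasure)
    (hlim : Tendsto V (cocompact ℝ) atTop) : IsConfining V where
  tendsto := hlim
  locallyIntegrable := by
    have hg : LocallyIntegrable (fun x => V x * Real.exp (-x ^ 2 / 2)) volume :=
      (memLp_hermiteMeasure_iff.1 hV).locallyIntegrable (by norm_num)
    refine (hg.continuous_mul (g := fun x => Real.exp (x ^ 2 / 2)) (by fun_prop)).congr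
      (Eventually.of_forall fun x => ?_)
    change Real.exp (x ^ 2 / 2) * (V x * Real.exp (-x ^ 2 / 2)) = V x
    rw [neg_div, mul_left_comm, ← Real.exp_add, add_neg_cancel, Real.exp_zero, mul_one]

namespace IsConfining

variable {V : ℝ → ℝ} (hV : IsConfining V)

include hV

lemma aestronglyMeasurable_posPart : AEStronglyMeasurable (fun x => (V x)⁺) volume :=
  hV.locallyIntegrable.aestronglyMeasurable.sup aestronglyMeasurable_const

lemma aestronglyMeasurable_negPart : AEStronglyMeasurable (fun x => (V x)⁻) volume :=
  hV.locallyIntegrable.aestronglyMeasurable.neg.sup aestronglyMeasurable_const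

lemma exists_le_of_le_abs (R : ℝ) : ∃ N, 0 < N ∧ ∀ x, N ≤ |x| → R ≤ V x := by
  have hev := hV.tendsto.eventually_ge_atTop R
  rw [← Metric.cobounded_eq_cocompact, ← comap_norm_atTop, eventually_comap] at hev
  obtain ⟨N, hN⟩ := eventually_atTop.1 hev
  exact ⟨max N 1, by positivity, fun x hx => hN |x| ((le_max_left _ _).trans hx) x rfl⟩

lemma integrable_negPart_mul {g : ℝ → ℝ} (hg : Continuous g) :
    Integrable fun x => (V x)⁻ * g x := by
  obtain ⟨K, hK, hKV⟩ := mem_cocompact.1 (hV.tendsto.eventually_ge_atTop 0)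
  have hint : IntegrableOn (fun x => (V x)⁻ * g x) K :=
    IntegrableOn.mul_continuousOn (hV.locallyIntegrable.integrableOn_isCompact hK).neg.pos_part
      hg.continuousOn hK
  refine (integrableOn_iff_integrable_of_support_subset fun x hx => ?_).1 hint
  by_contra hxK
  exact hx (mul_eq_zero_of_left (negPart_eq_zero.2 (hKV hxK)) (g x))

lemma integrable_negPart : Integrable fun x => (V x)⁻ := by
  simpa only [mul_one] using hV.integrable_negPart_mul (continuous_const (y := 1))

variable {u : ℝ → ℝ} (hu : Continuous u)

include hu

lemma integral_negPart_mul_sq_le {C : ℝ} (hC : ∀ x, u x ^ 2 ≤ C) :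
    ∫ x, (V x)⁻ * u x ^ 2 ≤ C * ∫ x, (V x)⁻ := by
  rw [← integral_const_mul]
  refine integral_mono (hV.integrable_negPart_mul (hu.pow 2)) (hV.integrable_negPart.const_mul C)
    fun x => ?_
  rw [mul_comm]
  exact mul_le_mul_of_nonneg_right (hC x) (negPart_nonneg _)

lemma memLp_sqrt_negPart_mul : MemLp (fun x => √(V x)⁻ * u x) 2 volume := by
  refine (memLp_two_iff_integrable_sq ((Real.continuous_sqrt.comp_aestronglyMeasurable
    hV.aestronglyMeasurable_negPart).mul hu.aestronglyMeasurable)).2 ?_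
  simpa only [Pi.mul_apply, Pi.pow_apply, mul_pow, Real.sq_sqrt (negPart_nonneg _)] using
    hV.integrable_negPart_mul (hu.pow 2)

end IsConfining

/-- The form domain of `-d²/dx² + V`, encoded as a closed subspace of `L² × L² × L² × L²`: its
elements are `(u, u', √V⁺ u, √V⁻ u)`, so that the graph norm of the form is the product norm. -/
noncomputable def formDomain (V : ℝ → ℝ) :
    Submodule ℝ (PiLp 2 fun _ : Fin 4 => ℝ →₂[volume] ℝ) where
  carrier := {f | (∃ c, ∀ᵐ x, f 0 x = primitive c (f 1) x) ∧
    (∀ᵐ x, f 2 x = √(V x)⁺ * f 0 x) ∧ ∀ᵐ x, f 3 x = √(V x)⁻ * f 0 x}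
  zero_mem' := by
    have h (i : Fin 4) : ∀ᵐ x, (0 : PiLp 2 fun _ : Fin 4 => ℝ →₂[volume] ℝ) i x = 0 :=
      Lp.coeFn_zero ℝ 2 volume
    refine ⟨⟨0, ?_⟩, ?_, ?_⟩
    · filter_upwards [h 0] with x hx
      rw [hx, primitive_congr_ae (h 1)]
      simp [primitive]
    · filter_upwards [h 0, h 2] with x h0 h2
      rw [h0, h2, mul_zero]
    · filter_upwards [h 0, h 3] with x h0 h3
      rw [h0, h3, mul_zero]
  add_mem' := by
    rintro f g ⟨⟨a, hf1⟩, hf2, hf3⟩ ⟨⟨b, hg1⟩, hg2, hg3⟩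
    have h (i : Fin 4) : ∀ᵐ x, (f + g) i x = f i x + g i x := Lp.coeFn_add (f i) (g i)
    have hint (f : ℝ →₂[volume] ℝ) (x : ℝ) : IntervalIntegrable f volume 0 x :=
      intervalIntegrable_of_locallyIntegrable (locallyIntegrable_Lp f) 0 x
    refine ⟨⟨a + b, ?_⟩, ?_, ?_⟩
    · filter_upwards [h 0, hf1, hg1] with x h0 h1 h2
      rw [h0, h1, h2, primitive_congr_ae (h 1), primitive, primitive, primitive,
        intervalIntegral.integral_add (hint _ _) (hint _ _)]
      ring
    · filter_upwards [h 0, h 2, hf2, hg2] with x h0 h2 hf hg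
      rw [h0, h2, hf, hg, mul_add]
    · filter_upwards [h 0, h 3, hf3, hg3] with x h0 h3 hf hg
      rw [h0, h3, hf, hg, mul_add]
  smul_mem' := by
    rintro r f ⟨⟨a, hf1⟩, hf2, hf3⟩
    have h (i : Fin 4) : ∀ᵐ x, (r • f) i x = r * f i x := Lp.coeFn_smul r (f i)
    refine ⟨⟨r * a, ?_⟩, ?_, ?_⟩
    · filter_upwards [h 0, hf1] with x h0 h1
      rw [h0, h1, primitive_congr_ae (h 1), primitive, primitive,
        intervalIntegral.integral_const_mul, mul_add]
    · filter_upwards [h 0, h 2, hf2] with x h0 h2 hf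
      rw [h0, h2, hf, mul_left_comm]
    · filter_upwards [h 0, h 3, hf3] with x h0 h3 hf
      rw [h0, h3, hf, mul_left_comm]

lemma isClosed_formDomain (V : ℝ → ℝ) :
    IsClosed (formDomain V : Set (PiLp 2 fun _ : Fin 4 => ℝ →₂[volume] ℝ)) := by
  refine IsSeqClosed.isClosed fun f f' hf hlim => ?_
  have h (i : Fin 4) : Tendsto (fun n => f n i) atTop (𝓝 (f' i)) :=
    ((PiLp.proj (𝕜 := ℝ) 2 (fun _ : Fin 4 => ℝ →₂[volume] ℝ) i).continuous.tendsto f').comp hlim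
  exact ⟨ae_eq_primitive_of_tendsto (h 0) (h 1) fun n => (hf n).1,
    ae_eq_mul_of_tendsto (h 0) (h 2) fun n => (hf n).2.1,
    ae_eq_mul_of_tendsto (h 0) (h 3) fun n => (hf n).2.2⟩

instance (V : ℝ → ℝ) : CompleteSpace (formDomain V) :=
  (isClosed_formDomain V).completeSpace_coe

namespace formDomain

variable {V : ℝ → ℝ}

/-- The `i`-th entry of the quadruple `(u, u', √V⁺ u, √V⁻ u)`. -/
noncomputable def coord (V : ℝ → ℝ) (i : Fin 4) : formDomain V →L[ℝ] ℝ →₂[volume] ℝ :=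
  (PiLp.proj 2 (fun _ : Fin 4 => ℝ →₂[volume] ℝ) i).comp (formDomain V).subtypeL

lemma norm_sq_eq (h : formDomain V) : ‖h‖ ^ 2 =
    ‖coord V 0 h‖ ^ 2 + ‖coord V 1 h‖ ^ 2 + ‖coord V 2 h‖ ^ 2 + ‖coord V 3 h‖ ^ 2 :=
  (PiLp.norm_sq_eq_of_L2 _ h.1).trans (Fin.sum_univ_four _)

/-- The continuous representative of the first entry of an element of the form domain. -/
noncomputable def rep (h : formDomain V) : ℝ → ℝ :=
  primitive h.2.1.choose (coord V 1 h)

section Rep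

variable (h k : formDomain V)

lemma coord_zero_ae : coord V 0 h =ᵐ[volume] rep h := h.2.1.choose_spec

lemma coord_two_ae : ∀ᵐ x, coord V 2 h x = √(V x)⁺ * rep h x := by
  filter_upwards [h.2.2.1, coord_zero_ae h] with x hx h0
  rw [← h0]
  exact hx

lemma coord_three_ae : ∀ᵐ x, coord V 3 h x = √(V x)⁻ * rep h x := by
  filter_upwards [h.2.2.2, coord_zero_ae h] with x hx h0
  rw [← h0]
  exact hx

lemma continuous_rep : Continuous (rep h) :=
  continuous_primitive (locallyIntegrable_Lp (coord V 1 h)) _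

lemma absolutelyContinuousOnInterval_rep (a b : ℝ) :
    AbsolutelyContinuousOnInterval (rep h) a b :=
  absolutelyContinuousOnInterval_primitive (locallyIntegrable_Lp (coord V 1 h)) _ a b

lemma ae_hasDerivAt_rep : ∀ᵐ x, HasDerivAt (rep h) (coord V 1 h x) x :=
  ae_hasDerivAt_primitive (locallyIntegrable_Lp (coord V 1 h)) _

lemma memLp_rep : MemLp (rep h) 2 volume := (Lp.memLp (coord V 0 h)).ae_eq (coord_zero_ae h)

lemma sq_rep_le (x : ℝ) {δ : ℝ} (hδ : 0 < δ) :
    rep h x ^ 2 ≤ 2 / δ * ‖coord V 0 h‖ ^ 2 + 2 * δ * ‖coord V 1 h‖ ^ 2 :=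
  sq_primitive_le (coord_zero_ae h) x hδ

variable {h} in
lemma rep_eq_of_ae_eq {u : ℝ → ℝ} (hu : Continuous u) (hhu : coord V 0 h =ᵐ[volume] u) :
    rep h = u :=
  ((continuous_rep h).ae_eq_iff_eq volume hu).1 ((coord_zero_ae h).symm.trans hhu)

lemma rep_add : rep (h + k) = rep h + rep k := by
  refine rep_eq_of_ae_eq ((continuous_rep h).add (continuous_rep k)) ?_
  rw [map_add]
  exact (Lp.coeFn_add _ _).trans ((coord_zero_ae h).add (coord_zero_ae k))

lemma rep_smul (r : ℝ) : rep (r • h) = r • rep h := by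
  refine rep_eq_of_ae_eq ((continuous_rep h).const_smul r) ?_
  rw [map_smul]
  exact (Lp.coeFn_smul _ _).trans ((coord_zero_ae h).const_smul r)

end Rep

/-- Evaluation of the continuous representative at the point `x`. -/
noncomputable def eval (V : ℝ → ℝ) (x : ℝ) : formDomain V →L[ℝ] ℝ :=
  LinearMap.mkContinuous
    { toFun h := rep h x
      map_add' h k := congrFun (rep_add h k) x
      map_smul' r h := congrFun (rep_smul h r) x } 2 fun h => by
    refine abs_le_of_sq_le_sq ((sq_rep_le h x one_pos).trans ?_) (by positivity)
    rw [mul_pow, norm_sq_eq]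
    nlinarith [sq_nonneg ‖coord V 0 h‖, sq_nonneg ‖coord V 1 h‖, sq_nonneg ‖coord V 2 h‖,
      sq_nonneg ‖coord V 3 h‖]

section OfMemLp

variable (hV : IsConfining V) {c : ℝ} {g : ℝ → ℝ} (hu : MemLp (primitive c g) 2 volume)
  (hg : MemLp g 2 volume) (hVu : MemLp (fun x => √(V x)⁺ * primitive c g x) 2 volume)

include hV hu hg hVu

lemma exists_rep_eq_primitive :
    ∃ h : formDomain V, rep h = primitive c g ∧ coord V 1 h =ᵐ[volume] g := by
  have hcont : Continuous (primitive c g) :=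
    continuous_primitive (hg.locallyIntegrable (by norm_num)) c
  have hu' := hu.coeFn_toLp
  have hprim : hu.toLp _ =ᵐ[volume] primitive c (hg.toLp g) := by
    rwa [primitive_congr_ae hg.coeFn_toLp]
  have hVu' := hV.memLp_sqrt_negPart_mul hcont
  let f : PiLp 2 fun _ : Fin 4 => ℝ →₂[volume] ℝ :=
    WithLp.toLp 2 ![hu.toLp _, hg.toLp g, hVu.toLp _, hVu'.toLp _]
  have hf : f ∈ formDomain V := by
    refine ⟨⟨c, hprim⟩, ?_, ?_⟩
    · filter_upwards [hu', hVu.coeFn_toLp] with x h0 h2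
      exact h2.trans (by rw [← h0]; rfl)
    · filter_upwards [hu', hVu'.coeFn_toLp] with x h0 h3
      exact h3.trans (by rw [← h0]; rfl)
  exact ⟨⟨f, hf⟩, rep_eq_of_ae_eq hcont hu', hg.coeFn_toLp⟩

end OfMemLp

/-- The Schrödinger form `∫ u' v' + ∫ V u v + c ∫ u v`, shifted by the constant `c`. -/
noncomputable def form (V : ℝ → ℝ) (c : ℝ) : formDomain V →L[ℝ] formDomain V →L[ℝ] ℝ :=
  (innerSL ℝ).bilinearComp (coord V 1) (coord V 1) +
    (innerSL ℝ).bilinearComp (coord V 2) (coord V 2) -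
    (innerSL ℝ).bilinearComp (coord V 3) (coord V 3) +
    c • (innerSL ℝ).bilinearComp (coord V 0) (coord V 0)

section Form

variable (c : ℝ) (h k : formDomain V)

lemma form_apply : form V c h k =
    inner ℝ (coord V 1 h) (coord V 1 k) + inner ℝ (coord V 2 h) (coord V 2 k) -
      inner ℝ (coord V 3 h) (coord V 3 k) + c * inner ℝ (coord V 0 h) (coord V 0 k) := rfl

lemma form_comm : form V c h k = form V c k h := by
  simp only [form_apply, real_inner_comm]

lemma inner_coord_zero : inner ℝ (coord V 0 h) (coord V 0 k) = ∫ x, rep h x * rep k x := by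
  rw [inner_Lp_eq_integral_mul]
  exact integral_congr_ae ((coord_zero_ae h).mul (coord_zero_ae k))

lemma coord_two_mul_sub_coord_three_mul_ae :
    (fun x => coord V 2 h x * coord V 2 k x - coord V 3 h x * coord V 3 k x) =ᵐ[volume]
      fun x => V x * (rep h x * rep k x) := by
  filter_upwards [coord_two_ae h, coord_two_ae k, coord_three_ae h, coord_three_ae k]
    with x h2 k2 h3 k3
  rw [h2, k2, h3, k3]
  linear_combination (rep h x * rep k x) * (Real.mul_self_sqrt (posPart_nonneg (V x)) -
    Real.mul_self_sqrt (negPart_nonneg (V x)) + posPart_sub_negPart (V x))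

lemma integrable_mul_rep_mul_rep : Integrable fun x => V x * (rep h x * rep k x) :=
  ((integrable_mul_Lp _ _).sub (integrable_mul_Lp _ _)).congr
    (coord_two_mul_sub_coord_three_mul_ae h k)

lemma form_eq_integral : form V c h k =
    (∫ x, coord V 1 h x * coord V 1 k x) + (∫ x, V x * (rep h x * rep k x)) +
      c * ∫ x, rep h x * rep k x := by
  rw [form_apply, inner_coord_zero, ← integral_congr_ae (coord_two_mul_sub_coord_three_mul_ae h k),
    integral_sub (integrable_mul_Lp _ _) (integrable_mul_Lp _ _)]
  simp only [inner_Lp_eq_integral_mul]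
  ring

end Form

lemma norm_sq_coord_three_le (hV : IsConfining V) (h : formDomain V) {δ : ℝ} (hδ : 0 < δ) :
    ‖coord V 3 h‖ ^ 2 ≤
      (2 / δ * ‖coord V 0 h‖ ^ 2 + 2 * δ * ‖coord V 1 h‖ ^ 2) * ∫ x, (V x)⁻ := by
  refine (hV.integral_negPart_mul_sq_le (continuous_rep h) fun x => sq_rep_le h x hδ).trans' ?_
  rw [norm_sq_Lp]
  refine (integral_congr_ae ((coord_three_ae h).mono fun x hx => ?_)).le
  simp only [hx, mul_pow, Real.sq_sqrt (negPart_nonneg _)]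

/-- `V⁻` is relatively form bounded with respect to `-d²/dx²`, with relative bound `1 / 2`. -/
lemma exists_norm_sq_coord_three_le (hV : IsConfining V) : ∃ C, 0 ≤ C ∧ ∀ h : formDomain V,
    ‖coord V 3 h‖ ^ 2 ≤ C * ‖coord V 0 h‖ ^ 2 + ‖coord V 1 h‖ ^ 2 / 2 := by
  set M := ∫ x, (V x)⁻
  have hM : 0 ≤ M := integral_nonneg fun x => negPart_nonneg _
  refine ⟨8 * (M + 1) * M, by positivity, fun h => ?_⟩
  calc ‖coord V 3 h‖ ^ 2
      ≤ (2 / (1 / (4 * (M + 1))) * ‖coord V 0 h‖ ^ 2 +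
          2 * (1 / (4 * (M + 1))) * ‖coord V 1 h‖ ^ 2) * M :=
        norm_sq_coord_three_le hV h (by positivity)
    _ = 8 * (M + 1) * M * ‖coord V 0 h‖ ^ 2 + M / (M + 1) * (‖coord V 1 h‖ ^ 2 / 2) := by
        field_simp
        ring
    _ ≤ 8 * (M + 1) * M * ‖coord V 0 h‖ ^ 2 + ‖coord V 1 h‖ ^ 2 / 2 := by
        gcongr
        exact mul_le_of_le_one_left (by positivity) (div_le_one_of_le₀ (by linarith) (by linarith))

lemma exists_isCoercive_form (hV : IsConfining V) : ∃ c, IsCoercive (form V c) := by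
  obtain ⟨C, hC, hbound⟩ := exists_norm_sq_coord_three_le hV
  refine ⟨C + 1, (3 + C)⁻¹, by positivity, fun h => ?_⟩
  have h3 := hbound h
  have h0 := sq_nonneg ‖coord V 0 h‖
  have h1 := sq_nonneg ‖coord V 1 h‖
  have h2 := sq_nonneg ‖coord V 2 h‖
  rw [mul_assoc, ← sq, inv_mul_le_iff₀ (by positivity), form_apply, norm_sq_eq]
  simp only [real_inner_self_eq_norm_sq]
  nlinarith [mul_nonneg hC h0, mul_nonneg hC h1, mul_nonneg hC h2]

end formDomain

/-! ### Compactness of the embedding of the form domain into `L²` -/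

namespace formDomain

variable {V : ℝ → ℝ}

/-- Sampling at the points `i δ`, `i ∈ s`: the element `h` of the form domain is replaced by the
step function with value `h (i δ)` on `[i δ, (i + 1) δ)` for `i ∈ s` and `0` elsewhere. -/
noncomputable def sampling (V : ℝ → ℝ) (δ : ℝ) (s : Finset ℤ) :
    formDomain V →L[ℝ] ℝ →₂[volume] ℝ :=
  ∑ i ∈ s, (eval V (i * δ)).smulRight (indicatorConstLp 2
    (measurableSet_Ico (a := (i : ℝ) * δ) (b := (i + 1) * δ)) measure_Ico_lt_top.ne 1)

lemma isCompactOperator_sampling (δ : ℝ) (s : Finset ℤ) : IsCompactOperator (sampling V δ s) :=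
  (compactOperator (RingHom.id ℝ) (formDomain V) (ℝ →₂[volume] ℝ)).sum_mem fun i _ =>
    (isCompactOperator_of_locallyCompactSpace_dom (eval V (i * δ))).clm_comp
      (ContinuousLinearMap.toSpanSingleton ℝ _)

variable {δ : ℝ} (hδ : 0 < δ)

include hδ

lemma mem_Ico_mul_iff (x : ℝ) (i : ℤ) : x ∈ Set.Ico (i * δ) ((i + 1) * δ) ↔ ⌊x / δ⌋ = i := by
  rw [Int.floor_eq_iff, le_div_iff₀ hδ, div_lt_iff₀ hδ, Set.mem_Ico]

lemma sampling_ae (s : Finset ℤ) (h : formDomain V) :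
    ∀ᵐ x, sampling V δ s h x = if ⌊x / δ⌋ ∈ s then rep h (⌊x / δ⌋ * δ) else 0 := by
  classical
  induction s using Finset.induction_on with
  | empty =>
    filter_upwards [Lp.coeFn_zero ℝ 2 volume] with x hx
    rw [sampling, Finset.sum_empty, _root_.zero_apply, hx]
    simp
  | insert i s hi ih =>
    let e : ℝ →₂[volume] ℝ := indicatorConstLp 2
      (measurableSet_Ico (a := (i : ℝ) * δ) (b := (i + 1) * δ)) measure_Ico_lt_top.ne (1 : ℝ)
    have hins : sampling V δ (insert i s) h = rep h (i * δ) • e + sampling V δ s h := by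
      rw [sampling, Finset.sum_insert hi]
      rfl
    rw [hins]
    filter_upwards [ih, Lp.coeFn_add (rep h (i * δ) • e) (sampling V δ s h),
      Lp.coeFn_smul (rep h (i * δ)) e, indicatorConstLp_coeFn (p := 2) (c := (1 : ℝ))
        (hs := measurableSet_Ico (a := (i : ℝ) * δ) (b := (i + 1) * δ))
        (hμs := measure_Ico_lt_top.ne)] with x hs hadd hsmul he
    rw [hadd, Pi.add_apply, hs, hsmul, Pi.smul_apply, he, Set.indicator_apply]
    simp only [mem_Ico_mul_iff hδ]
    rcases eq_or_ne ⌊x / δ⌋ i with hx | hx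
    · simp [hx, hi]
    · simp [hx]

lemma sq_rep_sub_rep_floor_le (h : formDomain V) (x : ℝ) :
    (rep h x - rep h (⌊x / δ⌋ * δ)) ^ 2 ≤ δ * ‖coord V 1 h‖ ^ 2 := by
  obtain ⟨hx, hx'⟩ := (mem_Ico_mul_iff hδ x _).2 rfl
  rw [rep, primitive_sub (locallyIntegrable_Lp _)]
  refine (sq_intervalIntegral_le _ _ _).trans ?_
  gcongr
  rw [abs_of_nonneg (by linarith)]
  linarith

variable {K : ℕ} {R : ℝ} (hR : 0 < R) (hV : ∀ x, K * δ ≤ |x| → R ≤ V x)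

include hR hV

/-- Outside `[-K δ, K δ)` the sampled function vanishes, and `u ^ 2 ≤ R⁻¹ (√V⁺ u) ^ 2`. -/
lemma sq_coord_zero_sub_sampling_le (h : formDomain V) :
    ∀ᵐ x, (coord V 0 h - sampling V δ (Finset.Ico (-K) K) h) x ^ 2 ≤
      (Set.Ico (-(K * δ)) (K * δ)).indicator (fun _ => δ * ‖coord V 1 h‖ ^ 2) x +
        R⁻¹ * coord V 2 h x ^ 2 := by
  filter_upwards [Lp.coeFn_sub (coord V 0 h) (sampling V δ (Finset.Ico (-K) K) h),
    coord_zero_ae h, coord_two_ae h, sampling_ae hδ (Finset.Ico (-K) K) h] with x hsub h0 h2 hs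
  have hmem : ⌊x / δ⌋ ∈ Finset.Ico (-(K : ℤ)) K ↔ x ∈ Set.Ico (-(K * δ)) (K * δ) := by
    rw [Finset.mem_Ico, Int.le_floor, Int.floor_lt, le_div_iff₀ hδ, div_lt_iff₀ hδ, Set.mem_Ico]
    push_cast
    rw [neg_mul]
  rw [hsub, Pi.sub_apply, h0, h2, hs, Set.indicator_apply]
  simp only [hmem]
  split_ifs with hx
  · exact (sq_rep_sub_rep_floor_le hδ h x).trans (le_add_of_nonneg_right (by positivity))
  · have hxK : K * δ ≤ |x| := by
      by_contra! hlt
      exact hx ⟨(abs_lt.1 hlt).1.le, (abs_lt.1 hlt).2⟩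
    rw [sub_zero, zero_add, mul_pow, Real.sq_sqrt (posPart_nonneg _), ← mul_assoc]
    refine le_mul_of_one_le_left (sq_nonneg _) ?_
    rw [← div_eq_inv_mul, one_le_div₀ hR]
    exact (hV x hxK).trans (le_posPart _)

lemma norm_sq_coord_zero_sub_sampling_le (h : formDomain V) :
    ‖coord V 0 h - sampling V δ (Finset.Ico (-K) K) h‖ ^ 2 ≤
      2 * K * δ ^ 2 * ‖coord V 1 h‖ ^ 2 + R⁻¹ * ‖coord V 2 h‖ ^ 2 := by
  have hind : Integrable
      ((Set.Ico (-(K * δ)) (K * δ)).indicator fun _ => δ * ‖coord V 1 h‖ ^ 2) :=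
    (integrable_indicator_iff measurableSet_Ico).2 (integrableOn_const measure_Ico_lt_top.ne)
  have hpot : Integrable fun x => R⁻¹ * coord V 2 h x ^ 2 :=
    (Lp.memLp (coord V 2 h)).integrable_sq.const_mul _
  have hle := integral_mono_ae (Lp.memLp _).integrable_sq (hind.add hpot)
    (sq_coord_zero_sub_sampling_le hδ hR hV h)
  rw [norm_sq_Lp, norm_sq_Lp (coord V 2 h)]
  refine hle.trans_eq ?_
  rw [integral_add' hind hpot, integral_indicator measurableSet_Ico, setIntegral_const,
    integral_const_mul, Real.volume_real_Ico_of_le (by linarith [mul_nonneg K.cast_nonneg hδ.le]),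
    smul_eq_mul]
  ring

omit hδ hR hV in
lemma exists_isCompactOperator_norm_sub_le (hV : IsConfining V) {ε : ℝ} (hε : 0 < ε) :
    ∃ P : formDomain V →L[ℝ] ℝ →₂[volume] ℝ, IsCompactOperator P ∧ ‖P - coord V 0‖ ≤ ε := by
  obtain ⟨N, hN0, hN⟩ := hV.exists_le_of_le_abs (ε ^ 2)⁻¹
  obtain ⟨K, hK⟩ := exists_nat_gt (2 * N ^ 2 / ε ^ 2)
  have hK0 : (0 : ℝ) < K := lt_of_le_of_lt (by positivity) hK
  have hKN : K * (N / K) = N := mul_div_cancel₀ N hK0.ne'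
  have hmesh : 2 * K * (N / K) ^ 2 ≤ ε ^ 2 := by
    rw [div_lt_iff₀ (by positivity)] at hK
    calc 2 * K * (N / K) ^ 2 = 2 * N ^ 2 / K := by field_simp
      _ ≤ ε ^ 2 := by rw [div_le_iff₀ hK0]; linarith
  refine ⟨sampling V (N / K) (Finset.Ico (-K) K), isCompactOperator_sampling _ _,
    ContinuousLinearMap.opNorm_le_bound _ hε.le fun h => ?_⟩
  have hle := norm_sq_coord_zero_sub_sampling_le (V := V) (K := K) (div_pos hN0 hK0)
    (inv_pos.2 (pow_pos hε 2)) (by rwa [hKN]) h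
  refine le_of_sq_le_sq ?_ (by positivity)
  calc ‖sampling V (N / K) (Finset.Ico (-K) K) h - coord V 0 h‖ ^ 2
      ≤ 2 * K * (N / K) ^ 2 * ‖coord V 1 h‖ ^ 2 + ε ^ 2 * ‖coord V 2 h‖ ^ 2 := by
        rwa [norm_sub_rev, ← inv_inv (ε ^ 2)]
    _ ≤ ε ^ 2 * ‖coord V 1 h‖ ^ 2 + ε ^ 2 * ‖coord V 2 h‖ ^ 2 := by gcongr
    _ ≤ (ε * ‖h‖) ^ 2 := by
        rw [mul_pow, norm_sq_eq]
        nlinarith [mul_nonneg (sq_nonneg ε) (sq_nonneg ‖coord V 0 h‖),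
          mul_nonneg (sq_nonneg ε) (sq_nonneg ‖coord V 3 h‖)]

omit hδ hR hV in
theorem isCompactOperator_coord_zero (hV : IsConfining V) : IsCompactOperator (coord V 0) := by
  choose P hP hPε using fun n : ℕ =>
    exists_isCompactOperator_norm_sub_le hV (Nat.one_div_pos_of_nat (α := ℝ) (n := n))
  have hlim : Tendsto (fun n => ‖P n - coord V 0‖) atTop (𝓝 0) :=
    squeeze_zero (fun n => norm_nonneg (P n - coord V 0)) hPε
      tendsto_one_div_add_atTop_nhds_zero_nat
  exact isCompactOperator_of_tendsto (F := P) (l := atTop)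
    ((tendsto_iff_norm_sub_tendsto_zero (E := formDomain V →L[ℝ] ℝ →₂[volume] ℝ)).2 hlim)
    (Eventually.of_forall hP)

end formDomain

/-! ### Solutions of the differential equation have finite energy -/

lemma frequently_deriv_lt_of_integrable {S S' : ℝ → ℝ} (hS : Integrable S)
    (hS' : ∀ x, HasDerivAt S (S' x) x) {ε : ℝ} (hε : 0 < ε) : ∃ᶠ x in atTop, S' x < ε := by
  by_contra hcon
  obtain ⟨a, ha⟩ := eventually_atTop.1 (not_frequently.1 hcon)
  have hgrowth : ∀ x, a ≤ x → ε * (x - a) + S a ≤ S x := fun x hx => by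
    have hdiff : Differentiable ℝ S := fun y => (hS' y).differentiableAt
    have hmvt := (convex_Ici a).mul_sub_le_image_sub_of_le_deriv hdiff.continuous.continuousOn
      hdiff.differentiableOn (C := ε) (fun y hy => by
        rw [interior_Ici] at hy
        exact (not_lt.1 (ha y hy.le)).trans_eq (hS' y).deriv.symm) a Set.self_mem_Ici x hx hx
    linarith
  have htop : Tendsto S atTop atTop :=
    tendsto_atTop_mono' atTop (eventually_atTop.2 ⟨a, hgrowth⟩)
      (tendsto_atTop_add_const_right _ _
        ((tendsto_atTop_add_const_right _ (-a) tendsto_id).const_mul_atTop hε))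
  obtain ⟨b, hb⟩ := eventually_atTop.1 (htop.eventually_ge_atTop 1)
  exact (hS.measure_norm_ge_lt_top one_pos).ne
    (measure_mono_top (fun x hx => (hb x hx).trans (le_abs_self _)) (Real.volume_Ici (a := b)))

lemma integrable_of_frequently_intervalIntegral_le {f : ℝ → ℝ} (hf : LocallyIntegrable f volume)
    (hf0 : ∀ x, 0 ≤ f x) {C : ℝ} (hC : ∃ᶠ x in atTop, ∫ t in -x..x, f t ≤ C) : Integrable f := by
  have : (atTop ⊓ 𝓟 {x | ∫ t in -x..x, f t ≤ C}).NeBot := frequently_iff_neBot.1 hC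
  refine integrable_of_intervalIntegral_norm_bounded C
    (l := atTop ⊓ 𝓟 {x | ∫ t in -x..x, f t ≤ C})
    (fun x => (hf.integrableOn_isCompact isCompact_Icc).mono_set Set.Ioc_subset_Icc_self)
    (tendsto_neg_atTop_atBot.mono_left inf_le_left) (tendsto_id.mono_left inf_le_left) ?_
  filter_upwards [mem_inf_of_right (mem_principal_self _)] with x hx
  simp only [Real.norm_of_nonneg (hf0 _)]
  exact hx

namespace IsL2Solution

variable {V : ℝ → ℝ} {μ : ℝ} {u : ℝ → ℝ}

section

variable (h : IsL2Solution V μ u)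

include h

lemma continuous_deriv : Continuous (deriv u) :=
  continuous_of_absolutelyContinuousOnInterval h.absolutelyContinuous_deriv

lemma eq_primitive : u = primitive (u 0) (deriv u) := by
  funext x
  rw [primitive, intervalIntegral.integral_deriv_eq_sub (fun y _ => h.differentiable y)
    (h.continuous_deriv.intervalIntegrable _ _), add_sub_cancel]

lemma absolutelyContinuousOnInterval (a b : ℝ) : AbsolutelyContinuousOnInterval u a b := by
  rw [h.eq_primitive]
  exact absolutelyContinuousOnInterval_primitive h.continuous_deriv.locallyIntegrable _ _ _

lemma ae_hasDerivAt_deriv_mul {v g : ℝ → ℝ} (hv : ∀ᵐ x, HasDerivAt v (g x) x) :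
    ∀ᵐ x, HasDerivAt (fun y => deriv u y * v y)
      ((V x - μ) * u x * v x + deriv u x * g x) x := by
  filter_upwards [h.ae_differentiableAt, h.equation, hv] with x hx heq hvx
  refine (hx.hasDerivAt.fun_mul hvx).congr_deriv ?_
  linear_combination (-v x) * heq

end

section

variable (hV : IsConfining V) (h : IsL2Solution V μ u)

include hV h

lemma locallyIntegrable_energy :
    LocallyIntegrable (fun x => deriv u x ^ 2 + (V x)⁺ * u x ^ 2) volume := by
  have hu := h.differentiable.continuous.pow 2
  refine ((h.continuous_deriv.pow 2).locallyIntegrable.add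
    ((hV.locallyIntegrable.continuous_mul hu).add
      (hV.integrable_negPart_mul hu).locallyIntegrable)).congr (Eventually.of_forall fun x => ?_)
  simp only [Pi.add_apply, Pi.pow_apply]
  linear_combination (-(u x ^ 2)) * posPart_sub_negPart (V x)

lemma integrable_negPart_add_mul_sq : Integrable fun x => (V x)⁻ * u x ^ 2 + μ * u x ^ 2 :=
  (hV.integrable_negPart_mul (h.differentiable.continuous.pow 2)).add
    (h.memLp.integrable_sq.const_mul μ)

lemma intervalIntegral_energy (a b : ℝ) : ∫ x in a..b, (deriv u x ^ 2 + (V x)⁺ * u x ^ 2) =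
    deriv u b * u b - deriv u a * u a + ∫ x in a..b, ((V x)⁻ * u x ^ 2 + μ * u x ^ 2) := by
  rw [← sub_eq_iff_eq_add, ← intervalIntegral.integral_sub
    (intervalIntegrable_of_locallyIntegrable (h.locallyIntegrable_energy hV) a b)
    (h.integrable_negPart_add_mul_sq hV).intervalIntegrable,
    ← integral_eq_sub_of_absolutelyContinuousOnInterval
      ((h.absolutelyContinuous_deriv a b).fun_mul (h.absolutelyContinuousOnInterval a b))
      (h.ae_hasDerivAt_deriv_mul (Eventually.of_forall fun x => (h.differentiable x).hasDerivAt))]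
  refine intervalIntegral.integral_congr fun x _ => ?_
  linear_combination (u x ^ 2) * posPart_sub_negPart (V x)

/-- The boundary terms `u u'` at `± x` are half the derivative of the integrable function
`u(x)² + u(-x)²`, hence cannot stay bounded away from zero. -/
lemma integrable_energy : Integrable fun x => deriv u x ^ 2 + (V x)⁺ * u x ^ 2 := by
  have hS : ∃ᶠ x in atTop, 2 * (deriv u x * u x - deriv u (-x) * u (-x)) < 2 := by
    refine frequently_deriv_lt_of_integrable
      (h.memLp.integrable_sq.add h.memLp.integrable_sq.comp_neg) (fun x => ?_) two_pos
    have hu (y : ℝ) := ((h.differentiable y).hasDerivAt).fun_pow 2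
    refine ((hu x).add ((hu (-x)).comp x (hasDerivAt_neg x))).congr_deriv ?_
    push_cast
    ring
  have hk := h.integrable_negPart_add_mul_sq hV
  refine integrable_of_frequently_intervalIntegral_le (h.locallyIntegrable_energy hV)
    (fun x => add_nonneg (sq_nonneg _) (mul_nonneg (posPart_nonneg _) (sq_nonneg _)))
    (C := 1 + ∫ x, ‖(V x)⁻ * u x ^ 2 + μ * u x ^ 2‖) (hS.mono fun x hx => ?_)
  have hle : ∫ t in -x..x, ((V t)⁻ * u t ^ 2 + μ * u t ^ 2) ≤
      ∫ t, ‖(V t)⁻ * u t ^ 2 + μ * u t ^ 2‖ :=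
    (le_abs_self _).trans (intervalIntegral.norm_integral_le_integral_norm_uIoc.trans
      (setIntegral_le_integral hk.norm (Eventually.of_forall fun t => norm_nonneg _)))
  rw [h.intervalIntegral_energy hV]
  linarith

lemma memLp_deriv : MemLp (deriv u) 2 volume := by
  refine (memLp_two_iff_integrable_sq h.continuous_deriv.aestronglyMeasurable).2
    ((h.integrable_energy hV).mono' (h.continuous_deriv.pow 2).aestronglyMeasurable
      (Eventually.of_forall fun x => ?_))
  rw [Real.norm_of_nonneg (sq_nonneg _)]
  exact le_add_of_nonneg_right (mul_nonneg (posPart_nonneg _) (sq_nonneg _))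

lemma memLp_sqrt_posPart_mul : MemLp (fun x => √(V x)⁺ * u x) 2 volume := by
  have hm : AEStronglyMeasurable (fun x => √(V x)⁺ * u x) volume :=
    (Real.continuous_sqrt.comp_aestronglyMeasurable hV.aestronglyMeasurable_posPart).mul
      h.differentiable.continuous.aestronglyMeasurable
  refine (memLp_two_iff_integrable_sq hm).2
    ((h.integrable_energy hV).mono' (hm.pow 2) (Eventually.of_forall fun x => ?_))
  rw [Real.norm_of_nonneg (sq_nonneg _), mul_pow, Real.sq_sqrt (posPart_nonneg _)]
  exact le_add_of_nonneg_left (sq_nonneg _)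

lemma exists_rep_eq : ∃ f : formDomain V, formDomain.rep f = u := by
  obtain ⟨f, hf, -⟩ := formDomain.exists_rep_eq_primitive hV (c := u 0) (g := deriv u)
    (h.eq_primitive ▸ h.memLp) (h.memLp_deriv hV) (h.eq_primitive ▸ h.memLp_sqrt_posPart_mul hV)
  exact ⟨f, hf.trans h.eq_primitive.symm⟩

end

lemma mem_formEigenspace {f : formDomain V} (h : IsL2Solution V μ (formDomain.rep f)) (c : ℝ) :
    f ∈ formEigenspace (formDomain.form V c) (formDomain.coord V 0) (μ + c) := by
  intro k
  set u := formDomain.rep f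
  set v := formDomain.rep k
  set g : ℝ → ℝ := ⇑(formDomain.coord V 1 k)
  have hderiv : formDomain.coord V 1 f =ᵐ[volume] deriv u :=
    (formDomain.ae_hasDerivAt_rep f).mono fun x hx => hx.deriv.symm
  have hVuv : Integrable fun x => V x * (u x * v x) := formDomain.integrable_mul_rep_mul_rep f k
  have huv : Integrable fun x => u x * v x :=
    (formDomain.memLp_rep f).integrable_mul (formDomain.memLp_rep k)
  have hdiff : Integrable fun x => V x * (u x * v x) - μ * (u x * v x) :=
    hVuv.sub (huv.const_mul μ)
  have hu'v : Integrable fun x => deriv u x * v x :=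
    (integrable_mul_Lp _ _).congr (hderiv.mul (formDomain.coord_zero_ae k))
  have hu'g : Integrable fun x => deriv u x * g x :=
    (integrable_mul_Lp _ _).congr (hderiv.mul (EventuallyEq.refl _ g))
  have hsplit : (fun x => (V x - μ) * u x * v x + deriv u x * g x) =
      fun x => V x * (u x * v x) - μ * (u x * v x) + deriv u x * g x := by
    funext x
    ring
  have hzero := integral_eq_zero_of_absolutelyContinuousOnInterval
    (fun a b => (h.absolutelyContinuous_deriv a b).fun_mul
      (formDomain.absolutelyContinuousOnInterval_rep k a b))
    (h.ae_hasDerivAt_deriv_mul (formDomain.ae_hasDerivAt_rep k)) hu'v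
    (hsplit ▸ hdiff.add hu'g)
  rw [hsplit, integral_add hdiff hu'g, integral_sub hVuv (huv.const_mul μ),
    integral_const_mul] at hzero
  have hcoord : ∫ x, formDomain.coord V 1 f x * formDomain.coord V 1 k x =
      ∫ x, deriv u x * g x := integral_congr_ae (hderiv.mul (EventuallyEq.refl _ g))
  rw [formDomain.form_eq_integral, formDomain.inner_coord_zero, hcoord]
  linear_combination hzero

end IsL2Solution

/-! ### Weak solutions solve the differential equation -/

section DuBoisReymond

open scoped ContDiff

lemma exists_hasCompactSupport_deriv_eq {p : ℝ → ℝ} (hp : ContDiff ℝ ∞ p)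
    (hsupp : HasCompactSupport p) (hp0 : ∫ x, p x = 0) :
    ∃ P : ℝ → ℝ, ContDiff ℝ ∞ P ∧ HasCompactSupport P ∧ deriv P = p := by
  have hint : Integrable p := hp.continuous.integrable_of_hasCompactSupport hsupp
  set P : ℝ → ℝ := fun x => ∫ t in Set.Iic x, p t
  have hprim : P = primitive (P 0) p := funext fun x => sub_eq_iff_eq_add'.1
    (intervalIntegral.integral_Iic_sub_Iic hint.integrableOn hint.integrableOn)
  have hderiv : ∀ x, HasDerivAt P (p x) x := fun x => by
    rw [hprim]
    exact (hp.continuous.integral_hasStrictDerivAt 0 x).hasDerivAt.const_add _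
  have hP' : deriv P = p := funext fun x => (hderiv x).deriv
  refine ⟨P, contDiff_infty_iff_deriv.2 ⟨fun x => (hderiv x).differentiableAt, hP' ▸ hp⟩, ?_, hP'⟩
  obtain ⟨N, hN⟩ := hsupp.isCompact.isBounded.subset_closedBall 0
  refine HasCompactSupport.of_support_subset_isCompact (isCompact_closedBall 0 N) fun x hx => ?_
  have hzero : ∀ y, N < |y| → p y = 0 := fun y hy => by
    by_contra hpy
    exact hy.not_ge (mem_closedBall_zero_iff.1 (hN (subset_tsupport p hpy)))
  rw [mem_closedBall_zero_iff, Real.norm_eq_abs]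
  by_contra! hxN
  refine hx ?_
  rcases lt_abs.1 hxN with hpos | hneg
  · refine (setIntegral_eq_integral_of_forall_compl_eq_zero fun y hy => ?_).trans hp0
    exact hzero y (lt_abs.2 (Or.inl (hpos.trans (not_le.1 hy))))
  · refine setIntegral_eq_zero_of_forall_eq_zero fun y (hy : y ≤ x) => ?_
    exact hzero y (lt_abs.2 (Or.inr (by linarith)))

/-- The du Bois-Reymond lemma. -/
lemma exists_ae_eq_const_of_integral_mul_deriv_eq_zero {h : ℝ → ℝ}
    (hh : LocallyIntegrable h volume)
    (hzero : ∀ φ : ℝ → ℝ, ContDiff ℝ ∞ φ → HasCompactSupport φ → ∫ x, h x * deriv φ x = 0) :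
    ∃ m, ∀ᵐ x, h x = m := by
  let ρ : ContDiffBump (0 : ℝ) := default
  set ψ : ℝ → ℝ := ρ.normed volume
  have hψ : ContDiff ℝ ∞ ψ := ρ.contDiff_normed
  have hψc : HasCompactSupport ψ := ρ.hasCompactSupport_normed
  have hint {φ : ℝ → ℝ} (hφ : ContDiff ℝ ∞ φ) (hφc : HasCompactSupport φ) :
      Integrable φ ∧ Integrable fun x => h x * φ x :=
    ⟨hφ.continuous.integrable_of_hasCompactSupport hφc,
      hh.integrable_smul_right_of_hasCompactSupport hφ.continuous hφc⟩
  refine ⟨∫ x, h x * ψ x, ?_⟩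
  have hae := ae_eq_zero_of_integral_contDiff_smul_eq_zero
    (hh.sub (locallyIntegrable_const (∫ x, h x * ψ x))) fun φ hφ hφc => ?_
  · filter_upwards [hae] with x hx using sub_eq_zero.1 hx
  -- Correcting `φ` by a multiple of `ψ` makes it the derivative of a test function.
  obtain ⟨hφi, hhφ⟩ := hint hφ hφc
  obtain ⟨hψi, hhψ⟩ := hint hψ hψc
  have hmean : ∫ x, (φ x - (∫ t, φ t) * ψ x) = 0 := by
    rw [integral_sub hφi (hψi.const_mul _), integral_const_mul, ρ.integral_normed, mul_one,
      sub_self]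
  obtain ⟨P, hP, hPc, hP'⟩ := exists_hasCompactSupport_deriv_eq
    (hφ.sub (contDiff_const.mul hψ)) (hφc.sub hψc.mul_left) hmean
  have hPzero := hzero P hP hPc
  simp only [hP', mul_sub, mul_left_comm (h _)] at hPzero
  rw [integral_sub hhφ (hhψ.const_mul _), integral_const_mul] at hPzero
  simp only [Pi.sub_apply, smul_eq_mul, mul_comm (φ _), sub_mul]
  rw [integral_sub hhφ (hφi.const_mul _), integral_const_mul]
  linear_combination hPzero

end DuBoisReymond

namespace formDomain

open scoped ContDiff

variable {V : ℝ → ℝ} (hV : IsConfining V)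

include hV

lemma exists_rep_eq_of_hasCompactSupport {φ : ℝ → ℝ} (hφ : ContDiff ℝ ∞ φ)
    (hφc : HasCompactSupport φ) :
    ∃ k : formDomain V, rep k = φ ∧ coord V 1 k =ᵐ[volume] deriv φ := by
  have hφ' : Continuous (deriv φ) := hφ.continuous_deriv (by simp)
  have hprim : φ = primitive (φ 0) (deriv φ) := by
    funext x
    rw [primitive, intervalIntegral.integral_deriv_eq_sub
      (fun y _ => (hφ.differentiable (by simp)).differentiableAt)
      (hφ'.intervalIntegrable _ _), add_sub_cancel]
  have hVφ : MemLp (fun x => √(V x)⁺ * φ x) 2 volume := by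
    refine (memLp_two_iff_integrable_sq ((Real.continuous_sqrt.comp_aestronglyMeasurable
      hV.aestronglyMeasurable_posPart).mul hφ.continuous.aestronglyMeasurable)).2 ?_
    have hsq : HasCompactSupport fun x => φ x ^ 2 := hφc.comp_left (g := (· ^ 2)) (by simp)
    refine ((hV.locallyIntegrable.integrable_smul_right_of_hasCompactSupport
      (hφ.continuous.pow 2) hsq).add (hV.integrable_negPart_mul (hφ.continuous.pow 2))).congr
      (Eventually.of_forall fun x => ?_)
    simp only [Pi.add_apply, Pi.mul_apply, Pi.pow_apply, smul_eq_mul, mul_pow,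
      Real.sq_sqrt (posPart_nonneg _)]
    linear_combination (-(φ x ^ 2)) * posPart_sub_negPart (V x)
  obtain ⟨k, hk, hk'⟩ := exists_rep_eq_primitive hV (c := φ 0) (g := deriv φ)
    (hprim ▸ hφ.continuous.memLp_of_hasCompactSupport hφc)
    (hφ'.memLp_of_hasCompactSupport hφc.deriv) (hprim ▸ hVφ)
  exact ⟨k, hk.trans hprim.symm, hk'⟩

lemma locallyIntegrable_sub_const_mul_rep (f : formDomain V) (μ : ℝ) :
    LocallyIntegrable (fun x => (V x - μ) * rep f x) volume :=
  ((hV.locallyIntegrable.sub (locallyIntegrable_const μ)).continuous_mul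
    (continuous_rep f)).congr (Eventually.of_forall fun x => mul_comm (rep f x) (V x - μ))

variable {c μ : ℝ} {f : formDomain V}
  (hf : f ∈ formEigenspace (form V c) (coord V 0) (μ + c))

include hf

omit hV in
lemma integral_coord_one_mul_add_eq_zero (k : formDomain V) :
    (∫ x, coord V 1 f x * coord V 1 k x) + ∫ x, (V x - μ) * rep f x * rep k x = 0 := by
  have hVfk := integrable_mul_rep_mul_rep f k
  have hfk : Integrable fun x => rep f x * rep k x := (memLp_rep f).integrable_mul (memLp_rep k)
  have hsplit : ∫ x, (V x - μ) * rep f x * rep k x =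
      (∫ x, V x * (rep f x * rep k x)) - μ * ∫ x, rep f x * rep k x := by
    rw [← integral_const_mul, ← integral_sub hVfk (hfk.const_mul μ)]
    exact integral_congr_ae (Eventually.of_forall fun x => by ring)
  have hweak := mem_formEigenspace.1 hf k
  rw [form_eq_integral, inner_coord_zero] at hweak
  rw [hsplit]
  linear_combination hweak

lemma integral_coord_one_sub_primitive_mul_deriv {φ : ℝ → ℝ} (hφ : ContDiff ℝ ∞ φ)
    (hφc : HasCompactSupport φ) :
    ∫ x, (coord V 1 f x - primitive 0 (fun y => (V y - μ) * rep f y) x) * deriv φ x = 0 := by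
  obtain ⟨k, hk, hk'⟩ := exists_rep_eq_of_hasCompactSupport hV hφ hφc
  set F : ℝ → ℝ := fun x => (V x - μ) * rep f x
  have hF : LocallyIntegrable F volume := locallyIntegrable_sub_const_mul_rep hV f μ
  set G := primitive 0 F
  have hG : Continuous G := continuous_primitive hF 0
  have hφ' : Continuous (deriv φ) := hφ.continuous_deriv (by simp)
  have hFφ : Integrable fun x => F x * φ x :=
    hF.integrable_smul_right_of_hasCompactSupport hφ.continuous hφc
  have hGφ' : Integrable fun x => G x * deriv φ x :=
    (hG.mul hφ').integrable_of_hasCompactSupport hφc.deriv.mul_left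
  have hgφ' : Integrable fun x => coord V 1 f x * deriv φ x :=
    (integrable_mul_Lp (coord V 1 f) (coord V 1 k)).congr
      ((EventuallyEq.refl _ _).mul hk')
  have hparts : ∫ x, (F x * φ x + G x * deriv φ x) = 0 :=
    integral_eq_zero_of_absolutelyContinuousOnInterval (f := fun x => G x * φ x)
      (fun a b => (absolutelyContinuousOnInterval_primitive hF 0 a b).fun_mul
        (hφ.of_le (by simp)).contDiffOn.absolutelyContinuousOnInterval)
      ((ae_hasDerivAt_primitive hF 0).mono fun x hx =>
        hx.fun_mul (hφ.differentiable (by simp) x).hasDerivAt)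
      ((hG.mul hφ.continuous).integrable_of_hasCompactSupport hφc.mul_left) (hFφ.add hGφ')
  have hweak := integral_coord_one_mul_add_eq_zero hf k
  have hcoord : ∫ x, coord V 1 f x * coord V 1 k x = ∫ x, coord V 1 f x * deriv φ x :=
    integral_congr_ae ((EventuallyEq.refl _ _).mul hk')
  rw [hk, hcoord] at hweak
  rw [integral_add hFφ hGφ'] at hparts
  simp only [sub_mul]
  rw [integral_sub hgφ' hGφ']
  linear_combination hweak - hparts

lemma exists_coord_one_ae_eq_primitive :
    ∃ m, coord V 1 f =ᵐ[volume] primitive m fun x => (V x - μ) * rep f x := by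
  have hF := locallyIntegrable_sub_const_mul_rep hV f μ
  obtain ⟨m, hm⟩ := exists_ae_eq_const_of_integral_mul_deriv_eq_zero
    ((locallyIntegrable_Lp (coord V 1 f)).sub (continuous_primitive hF 0).locallyIntegrable)
    fun φ hφ hφc => integral_coord_one_sub_primitive_mul_deriv hV hf hφ hφc
  refine ⟨m, hm.mono fun x hx => ?_⟩
  rw [Pi.sub_apply, primitive, zero_add, sub_eq_iff_eq_add] at hx
  exact hx

lemma isL2Solution_rep : IsL2Solution V μ (rep f) := by
  have hF := locallyIntegrable_sub_const_mul_rep hV f μ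
  obtain ⟨m, hm⟩ := exists_coord_one_ae_eq_primitive hV hf
  set G := primitive m fun x => (V x - μ) * rep f x
  have hG : Continuous G := continuous_primitive hF m
  have hrep : ∀ x, HasDerivAt (rep f) (G x) x := fun x => by
    rw [rep, primitive_congr_ae hm]
    exact (hG.integral_hasStrictDerivAt 0 x).hasDerivAt.const_add _
  have hderiv : deriv (rep f) = G := funext fun x => (hrep x).deriv
  refine ⟨memLp_rep f, fun x => (hrep x).differentiableAt, fun a b => ?_, ?_⟩
  · rw [hderiv]
    exact absolutelyContinuousOnInterval_primitive hF m a b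
  · filter_upwards [ae_hasDerivAt_primitive hF m] with x hx
    rw [hderiv, hx.deriv]
    ring

end formDomain

/-! ### Eigenspaces of the form and of the differential operator -/

namespace formDomain

variable {V : ℝ → ℝ}

/-- Passage to the continuous representative, as a linear map. -/
noncomputable def repLinear (V : ℝ → ℝ) : formDomain V →ₗ[ℝ] ℝ → ℝ where
  toFun := rep
  map_add' := rep_add
  map_smul' r h := rep_smul h r

lemma repLinear_injective : Function.Injective (repLinear V) := by
  refine (injective_iff_map_eq_zero _).2 fun h (hh : rep h = 0) => ?_
  have h0 : coord V 0 h = 0 := Lp.eq_zero_iff_ae_eq_zero.2 (hh ▸ coord_zero_ae h)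
  have hderiv (x : ℝ) : HasDerivAt (rep h) 0 x := by
    rw [hh]
    exact hasDerivAt_const x 0
  have h1 : coord V 1 h = 0 := Lp.eq_zero_iff_ae_eq_zero.2 <|
    (ae_hasDerivAt_rep h).mono fun x hx => hx.unique (hderiv x)
  have h2 : coord V 2 h = 0 := Lp.eq_zero_iff_ae_eq_zero.2 <|
    (coord_two_ae h).mono fun x hx => by rw [hx, hh, Pi.zero_apply, mul_zero]
  have h3 : coord V 3 h = 0 := Lp.eq_zero_iff_ae_eq_zero.2 <|
    (coord_three_ae h).mono fun x hx => by rw [hx, hh, Pi.zero_apply, mul_zero]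
  have hnorm := norm_sq_eq h
  rw [h0, h1, h2, h3] at hnorm
  simpa using hnorm

lemma map_repLinear_formEigenspace (hV : IsConfining V) (c μ : ℝ) :
    (formEigenspace (form V c) (coord V 0) (μ + c)).map (repLinear V) =
      schrodingerEigenspace V μ := by
  ext u
  constructor
  · rintro ⟨f, hf, rfl⟩
    exact isL2Solution_rep hV hf
  · intro (hu : IsL2Solution V μ u)
    obtain ⟨f, rfl⟩ := hu.exists_rep_eq hV
    exact ⟨f, hu.mem_formEigenspace c, rfl⟩

lemma rank_schrodingerEigenspace (hV : IsConfining V) (c μ : ℝ) :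
    Module.rank ℝ (schrodingerEigenspace V μ) =
      Module.rank ℝ (formEigenspace (form V c) (coord V 0) (μ + c)) := by
  rw [← map_repLinear_formEigenspace hV c]
  exact (Submodule.equivMapOfInjective _ repLinear_injective _).rank_eq.symm

end formDomain

open formDomain in
lemma isEigenvalueSequence_iff {V : ℝ → ℝ} (hV : IsConfining V) {c : ℝ}
    (hform : IsCompactForm (form V c) (coord V 0)) {lam : ℕ → ℝ} :
    IsEigenvalueSequence V lam ↔ IsMultiplicityListing
      (fun α => Module.finrank ℝ (formEigenspace (form V c) (coord V 0) α))
      fun k => lam k + c := by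
  have hcard (hlam : Tendsto lam atTop atTop) (μ : ℝ) :
      Cardinal.mk {k // lam k = μ} = Module.rank ℝ (schrodingerEigenspace V μ) ↔
        Nat.card {k // lam k + c = μ + c} =
          Module.finrank ℝ (formEigenspace (form V c) (coord V 0) (μ + c)) := by
    have := finite_fiber_of_tendsto_atTop hlam μ
    have := hform.finiteDimensional_formEigenspace (μ + c)
    simp only [add_left_inj]
    rw [rank_schrodingerEigenspace hV c, ← Module.finrank_eq_rank, ← Nat.cast_card, Nat.cast_inj]
  constructor
  · refine fun h => ⟨h.monotone.add_const c, tendsto_atTop_add_const_right _ c h.tendsto,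
      fun α => ?_⟩
    have hfiber := (hcard h.tendsto (α - c)).1 (h.multiplicity (α - c))
    rwa [sub_add_cancel] at hfiber
  · intro h
    have hlam : Tendsto lam atTop atTop := by
      simpa only [add_neg_cancel_right] using tendsto_atTop_add_const_right _ (-c) h.tendsto
    exact ⟨fun i j hij => le_of_add_le_add_right (h.monotone hij), hlam,
      fun μ => (hcard hlam μ).2 (h.card_fiber (μ + c))⟩

/-! ### Hermite functions -/

/-- The product of a polynomial with the Gaussian `e^{-x^2/2}`; the Hermite functions are the case
of the normalized Hermite polynomials. -/
noncomputable def gaussPoly (P : ℝ[X]) (x : ℝ) : ℝ := P.eval x * Real.exp (-x ^ 2 / 2)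

lemma continuous_gaussPoly (P : ℝ[X]) : Continuous (gaussPoly P) := P.continuous.mul (by fun_prop)

lemma memLp_gaussPoly (P : ℝ[X]) : MemLp (gaussPoly P) 2 volume :=
  memLp_hermiteMeasure_iff.1 (memLp_polynomial_hermiteMeasure P)

lemma hasDerivAt_gaussPoly (P : ℝ[X]) (x : ℝ) :
    HasDerivAt (gaussPoly P) (gaussPoly (derivative P - X * P) x) x := by
  have hexp : HasDerivAt (fun x : ℝ => -x ^ 2 / 2) (-x) x :=
    ((hasDerivAt_pow 2 x).fun_neg.div_const 2).congr_deriv (by push_cast; ring)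
  refine ((P.hasDerivAt x).mul hexp.exp).congr_deriv ?_
  simp only [gaussPoly, eval_sub, eval_mul, eval_X]
  ring

lemma deriv_gaussPoly (P : ℝ[X]) : deriv (gaussPoly P) = gaussPoly (derivative P - X * P) :=
  funext fun x => (hasDerivAt_gaussPoly P x).deriv

lemma gaussPoly_eq_primitive (P : ℝ[X]) :
    gaussPoly P = primitive (gaussPoly P 0) (gaussPoly (derivative P - X * P)) := by
  funext x
  rw [primitive, intervalIntegral.integral_eq_sub_of_hasDerivAt
    (fun y _ => hasDerivAt_gaussPoly P y) ((continuous_gaussPoly _).intervalIntegrable _ _)]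
  ring

lemma gaussPoly_mul_gaussPoly (P Q : ℝ[X]) (x : ℝ) :
    gaussPoly P x * gaussPoly Q x = (P * Q).eval x * Real.exp (-x ^ 2) := by
  rw [gaussPoly, gaussPoly, mul_mul_mul_comm, exp_neg_sq_div_two_mul_self, eval_mul]

lemma integral_mul_gaussPoly_mul_gaussPoly (V : ℝ → ℝ) (P Q : ℝ[X]) :
    ∫ x, V x * (gaussPoly P x * gaussPoly Q x) = ∫ x, V x * (P * Q).eval x ∂hermiteMeasure := by
  simp only [integral_hermiteMeasure, gaussPoly_mul_gaussPoly, mul_assoc]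

lemma integral_gaussPoly_mul_gaussPoly (P Q : ℝ[X]) :
    ∫ x, gaussPoly P x * gaussPoly Q x = gaussInt (P * Q) := by
  simpa only [gaussInt_apply, one_mul] using
    integral_mul_gaussPoly_mul_gaussPoly (fun _ => 1) P Q

lemma orthonormal_toLp_gaussPoly_unitHermite :
    Orthonormal ℝ fun n => (memLp_gaussPoly (unitHermite n)).toLp _ :=
  orthonormal_iff_ite.2 fun m n => by
    rw [inner_toLp_toLp, integral_gaussPoly_mul_gaussPoly, gaussInt_unitHermite_mul_unitHermite]

/-- `f ↦ e^{x^2/2} f` maps `L²(ℝ)` to `L²(e^{-x^2} dx)` and Hermite functions to Hermite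
polynomials. -/
lemma eq_zero_of_forall_inner_gaussPoly_unitHermite {f : ℝ →₂[volume] ℝ}
    (h : ∀ n, inner ℝ ((memLp_gaussPoly (unitHermite n)).toLp _) f = 0) : f = 0 := by
  have hinv (x : ℝ) : Real.exp (x ^ 2 / 2) * Real.exp (-x ^ 2 / 2) = 1 := by
    rw [neg_div, ← Real.exp_add, add_neg_cancel, Real.exp_zero]
  have hg : MemLp (fun x => f x * Real.exp (x ^ 2 / 2)) 2 hermiteMeasure := by
    simpa only [memLp_hermiteMeasure_iff, mul_assoc, hinv, mul_one] using Lp.memLp f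
  have hg0 : hg.toLp _ = 0 := eq_zero_of_forall_inner_polyLp_unitHermite fun n => by
    rw [inner_polyLp_toLp, integral_hermiteMeasure, ← h n, ← Lp.toLp_coeFn f (Lp.memLp f),
      inner_toLp_toLp, Lp.toLp_coeFn]
    congr 1 with x
    rw [← exp_neg_sq_div_two_mul_self, gaussPoly]
    linear_combination (eval x (unitHermite n) * f x * Real.exp (-x ^ 2 / 2)) * hinv x
  have hg0_ae := hg.coeFn_toLp.symm.trans (Lp.eq_zero_iff_ae_eq_zero.1 hg0)
  rw [EventuallyEq, ae_hermiteMeasure] at hg0_ae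
  exact Lp.eq_zero_iff_ae_eq_zero.2 <| hg0_ae.mono fun x hx =>
    (mul_eq_zero.1 hx).resolve_right (Real.exp_ne_zero _)

/-- The Hilbert basis of Hermite functions of `L²(ℝ)`. -/
noncomputable def hermiteFunctionBasis : HilbertBasis ℕ ℝ (ℝ →₂[volume] ℝ) :=
  HilbertBasis.mkOfOrthogonalEqBot orthonormal_toLp_gaussPoly_unitHermite <|
    (Submodule.eq_bot_iff _).2 fun _ hf => eq_zero_of_forall_inner_gaussPoly_unitHermite fun n =>
      hf _ (Submodule.subset_span (Set.mem_range_self n))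

lemma hermiteFunctionBasis_apply (n : ℕ) :
    hermiteFunctionBasis n = (memLp_gaussPoly (unitHermite n)).toLp _ :=
  congrFun (HilbertBasis.coe_mkOfOrthogonalEqBot _ _) n

lemma memLp_sqrt_posPart_mul_gaussPoly {V : ℝ → ℝ} (hV : MemLp V 2 hermiteMeasure) (P : ℝ[X]) :
    MemLp (fun x => √(V x)⁺ * gaussPoly P x) 2 volume := by
  have hmeas : AEStronglyMeasurable (fun x => √(V x)⁺) volume :=
    Real.continuous_sqrt.comp_aestronglyMeasurable
      ((aestronglyMeasurable_hermiteMeasure_iff.1 hV.1).sup aestronglyMeasurable_const)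
  refine (memLp_two_iff_integrable_sq
    (hmeas.mul (continuous_gaussPoly P).aestronglyMeasurable)).2 ?_
  refine (integrable_hermiteMeasure_iff.1 (integrable_mul_polynomial hV (P * P))).pos_part.congr
    (Eventually.of_forall fun x => ?_)
  change (V x * (P * P).eval x * Real.exp (-x ^ 2))⁺ = (√(V x)⁺ * gaussPoly P x) ^ 2
  rw [mul_assoc, ← gaussPoly_mul_gaussPoly, ← sq, mul_pow, Real.sq_sqrt (posPart_nonneg _),
    posPart_def, posPart_def, max_mul_of_nonneg _ _ (sq_nonneg _), zero_mul]

namespace formDomain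

variable {V : ℝ → ℝ} (hV : MemLp V 2 hermiteMeasure) (hlim : Tendsto V (cocompact ℝ) atTop)

include hV hlim

lemma exists_rep_eq_gaussPoly (P : ℝ[X]) : ∃ h : formDomain V, rep h = gaussPoly P ∧
    coord V 1 h =ᵐ[volume] gaussPoly (derivative P - X * P) := by
  obtain ⟨h, h0, h1⟩ := exists_rep_eq_primitive (isConfining_of_memLp hV hlim)
    (gaussPoly_eq_primitive P ▸ memLp_gaussPoly P) (memLp_gaussPoly (derivative P - X * P))
    (gaussPoly_eq_primitive P ▸ memLp_sqrt_posPart_mul_gaussPoly hV P)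
  exact ⟨h, h0.trans (gaussPoly_eq_primitive P).symm, h1⟩

lemma exists_rep_eq_hermiteFunction (n : ℕ) : ∃ h : formDomain V,
    rep h = gaussPoly (unitHermite n) ∧ coord V 0 h = hermiteFunctionBasis n ∧
      ∀ c, form V c h h = hermiteEnergy V n + c := by
  obtain ⟨h, h0, h1⟩ := exists_rep_eq_gaussPoly hV hlim (unitHermite n)
  refine ⟨h, h0, ?_, fun c => ?_⟩
  · rw [hermiteFunctionBasis_apply]
    have hae := coord_zero_ae h
    rw [h0] at hae
    exact Lp.ext (hae.trans (memLp_gaussPoly _).coeFn_toLp.symm)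
  · set Q := derivative (unitHermite n) - X * unitHermite n
    have hkinetic : ∫ x, coord V 1 h x * coord V 1 h x = ∫ x, gaussPoly Q x * gaussPoly Q x :=
      integral_congr_ae (h1.mul h1)
    rw [form_eq_integral, hkinetic, h0, integral_mul_gaussPoly_mul_gaussPoly,
      integral_gaussPoly_mul_gaussPoly, integral_gaussPoly_mul_gaussPoly, ← sq, ← sq,
      gaussInt_derivative_sub_X_mul_sq, gaussInt_derivative_unitHermite_sq,
      gaussInt_unitHermite_sq, gaussInt_X_sq_mul_unitHermite_sq, hermiteEnergy]
    ring

lemma denseRange_coord_zero : DenseRange (coord V 0) := by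
  have hspan : Submodule.span ℝ (Set.range hermiteFunctionBasis) ≤
      LinearMap.range (coord V 0 : formDomain V →ₗ[ℝ] ℝ →₂[volume] ℝ) := by
    refine Submodule.span_le.2 (Set.range_subset_iff.2 fun n => ?_)
    obtain ⟨h, -, h0, -⟩ := exists_rep_eq_hermiteFunction hV hlim n
    exact ⟨h, h0⟩
  exact (Submodule.dense_iff_topologicalClosure_eq_top.2 hermiteFunctionBasis.dense_span).mono hspan

lemma exists_isCompactForm : ∃ c, IsCompactForm (form V c) (coord V 0) := by
  have hconf := isConfining_of_memLp hV hlim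
  obtain ⟨c, hc⟩ := exists_isCoercive_form hconf
  exact ⟨c, form_comm c, hc, isCompactOperator_coord_zero hconf, denseRange_coord_zero hV hlim⟩

end formDomain

/-! ### Eigenvalue sums -/

section Eigenvalues

open formDomain

variable {V : ℝ → ℝ} (hV : MemLp V 2 hermiteMeasure) (hlim : Tendsto V (cocompact ℝ) atTop)

include hV hlim

lemma exists_isEigenvalueSequence : ∃ lam, IsEigenvalueSequence V lam := by
  obtain ⟨c, hform⟩ := exists_isCompactForm hV hlim
  have hinf : ¬ FiniteDimensional ℝ (ℝ →₂[volume] ℝ) := fun _ =>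
    not_finite_iff_infinite.2 inferInstance
      hermiteFunctionBasis.orthonormal.linearIndependent.finite
  obtain ⟨a, ha⟩ := hform.exists_isMultiplicityListing hinf
  refine ⟨fun k => a k - c, (isEigenvalueSequence_iff (isConfining_of_memLp hV hlim) hform).2 ?_⟩
  simpa only [sub_add_cancel] using ha

variable {lam : ℕ → ℝ} (hlam : IsEigenvalueSequence V lam)

include hlam

lemma sum_range_le_sum_range_hermiteEnergy (n : ℕ) :
    ∑ k ∈ Finset.range n, lam k ≤ ∑ k ∈ Finset.range n, hermiteEnergy V k := by
  obtain ⟨c, hform⟩ := exists_isCompactForm hV hlim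
  have ha := (isEigenvalueSequence_iff (isConfining_of_memLp hV hlim) hform).1 hlam
  obtain ⟨b, x, hx⟩ := hform.exists_hilbertBasis_formEigenspace ha
  choose w _ hw0 hw using exists_rep_eq_hermiteFunction hV hlim
  have horth : Orthonormal ℝ fun k => coord V 0 (w k) := by
    simpa only [hw0] using hermiteFunctionBasis.orthonormal
  have hsum := sum_range_le_sum_range_form hform.symm hform.form_self_nonneg ha.monotone
    (fun k => (hx k).1) b (fun k => (hx k).2) horth n
  simpa only [hw, Finset.sum_add_distrib, add_le_add_iff_right] using hsum

/-- The variational principle with the Hermite functions as eigenvectors and the eigenfunctions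
for `lam` as trial functions. -/
lemma sum_range_le_sum_range_of_isL2Solution_hermiteFunction {a : ℕ → ℝ} (ha : Monotone a)
    (hsol : ∀ k, IsL2Solution V (a k) (gaussPoly (unitHermite k))) (n : ℕ) :
    ∑ k ∈ Finset.range n, a k ≤ ∑ k ∈ Finset.range n, lam k := by
  obtain ⟨c, hform⟩ := exists_isCompactForm hV hlim
  obtain ⟨b, x, hx⟩ := hform.exists_hilbertBasis_formEigenspace
    ((isEigenvalueSequence_iff (isConfining_of_memLp hV hlim) hform).1 hlam)
  choose w hw hw0 _ using exists_rep_eq_hermiteFunction hV hlim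
  have hxx (k : ℕ) : form V c (x k) (x k) = lam k + c := by
    rw [mem_formEigenspace.1 (hx k).1, (hx k).2, real_inner_self_eq_norm_sq, b.orthonormal.1,
      one_pow, mul_one]
  have hmem (k : ℕ) : w k ∈ formEigenspace (form V c) (coord V 0) (a k + c) :=
    IsL2Solution.mem_formEigenspace (by simpa only [hw] using hsol k) c
  have horth : Orthonormal ℝ fun k => coord V 0 (x k) := by
    simpa only [hx] using b.orthonormal
  have hsum := sum_range_le_sum_range_form hform.symm hform.form_self_nonneg (ha.add_const c)
    hmem hermiteFunctionBasis hw0 horth n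
  simpa only [hxx, Finset.sum_add_distrib, add_le_add_iff_right] using hsum

end Eigenvalues

/-! ### The harmonic oscillator -/

lemma memLp_sq_hermiteMeasure : MemLp (fun x : ℝ => x ^ 2) 2 hermiteMeasure := by
  have h := memLp_polynomial_hermiteMeasure (X ^ 2)
  simp only [eval_pow, eval_X] at h
  exact h

lemma tendsto_sq_cocompact : Tendsto (fun x : ℝ => x ^ 2) (cocompact ℝ) atTop :=
  ((tendsto_pow_atTop two_ne_zero).comp (tendsto_norm_cocompact_atTop (E := ℝ))).congr
    fun x => sq_abs x

lemma hermiteEnergy_sq (k : ℕ) : hermiteEnergy (fun x => x ^ 2) k = 2 * k + 1 := by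
  have hpotential : ∫ x, x ^ 2 * (unitHermite k ^ 2).eval x ∂hermiteMeasure = k + 1 / 2 := by
    simpa only [gaussInt_apply, eval_mul, eval_pow, eval_X] using
      gaussInt_X_sq_mul_unitHermite_sq k
  rw [hermiteEnergy, hpotential]
  ring

lemma derivative_derivative_physHermite (n : ℕ) : derivative (derivative (physHermite n)) =
    2 * X * derivative (physHermite n) - (2 * n : ℝ) • physHermite n := by
  have h := derivative_physHermite_succ n
  rw [physHermite, derivative_sub, derivative_mul, derivative_mul, derivative_X,
    derivative_ofNat, smul_eq_C_mul] at h
  simp only [smul_eq_C_mul, map_mul, map_add, map_one, map_ofNat] at h ⊢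
  linear_combination -h

lemma derivative_derivative_unitHermite (n : ℕ) : derivative (derivative (unitHermite n)) =
    2 * X * derivative (unitHermite n) - (2 * n : ℝ) • unitHermite n := by
  simp only [unitHermite, derivative_smul, derivative_derivative_physHermite, smul_sub,
    mul_smul_comm, smul_comm (2 * n : ℝ)]

lemma isL2Solution_hermiteFunction (n : ℕ) :
    IsL2Solution (fun x => x ^ 2) (2 * n + 1) (gaussPoly (unitHermite n)) where
  memLp := memLp_gaussPoly _
  differentiable x := (hasDerivAt_gaussPoly _ x).differentiableAt
  absolutelyContinuous_deriv a b := by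
    rw [deriv_gaussPoly, gaussPoly_eq_primitive]
    exact absolutelyContinuousOnInterval_primitive (continuous_gaussPoly _).locallyIntegrable _ _ _
  equation := Eventually.of_forall fun x => by
    have hode := congrArg (eval x) (derivative_derivative_unitHermite n)
    simp only [eval_sub, eval_mul, eval_X, eval_ofNat, eval_smul, smul_eq_mul] at hode
    rw [deriv_gaussPoly, deriv_gaussPoly]
    simp only [gaussPoly, derivative_sub, derivative_mul, derivative_X, eval_sub, eval_add,
      eval_mul, eval_X, eval_one]
    linear_combination -Real.exp (-x ^ 2 / 2) * hode

lemma sum_range_hermiteEnergy_sq_le {lam : ℕ → ℝ}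
    (hlam : IsEigenvalueSequence (fun x => x ^ 2) lam) (n : ℕ) :
    ∑ k ∈ Finset.range n, hermiteEnergy (fun x => x ^ 2) k ≤ ∑ k ∈ Finset.range n, lam k := by
  simp only [hermiteEnergy_sq]
  refine sum_range_le_sum_range_of_isL2Solution_hermiteFunction memLp_sq_hermiteMeasure
    tendsto_sq_cocompact hlam (fun i j hij => ?_) isL2Solution_hermiteFunction n
  gcongr

theorem theorem5p1 :
    (∀ V : ℝ → ℝ, MemLp V 2 hermiteMeasure → Tendsto V (cocompact ℝ) atTop →
      (∃ v : ℕ → ℝ, HasHermiteExpansion V v) ∧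
      (∃ lam : ℕ → ℝ, IsEigenvalueSequence V lam) ∧
      ∀ v lam : ℕ → ℝ, HasHermiteExpansion V v → IsEigenvalueSequence V lam →
        ∀ n : ℕ, ∑ k ∈ Finset.range (n + 1), lam k ≤ hermiteBound v n) ∧
    (MemLp (fun x : ℝ => x ^ 2) 2 hermiteMeasure ∧
      Tendsto (fun x : ℝ => x ^ 2) (cocompact ℝ) atTop ∧
      ∀ v lam : ℕ → ℝ, HasHermiteExpansion (fun x => x ^ 2) v →
        IsEigenvalueSequence (fun x => x ^ 2) lam →
        ∀ n : ℕ, ∑ k ∈ Finset.range (n + 1), lam k = hermiteBound v n) := by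
  refine ⟨fun V hV hlim => ⟨exists_hasHermiteExpansion hV, exists_isEigenvalueSequence hV hlim,
    fun v lam hv hlam n => ?_⟩, memLp_sq_hermiteMeasure, tendsto_sq_cocompact,
    fun v lam hv hlam n => ?_⟩
  · rw [hermiteBound_eq_sum_hermiteEnergy hV hv]
    exact sum_range_le_sum_range_hermiteEnergy hV hlim hlam (n + 1)
  · rw [hermiteBound_eq_sum_hermiteEnergy memLp_sq_hermiteMeasure hv]
    exact le_antisymm (sum_range_le_sum_range_hermiteEnergy memLp_sq_hermiteMeasure
      tendsto_sq_cocompact hlam (n + 1)) (sum_range_hermiteEnergy_sq_le hlam (n + 1))
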